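/- **Conventions.** A *skew lattice* is a set $A$ with idempotent associative operations $\land,\lor$ satisfying $x\land(x\lor y)=x=(y\lor x)\land x$ and $x\lor(x\land y)=x=(y\land x)\lor x$. Its natural partial order is $x\le y\iff x\land y=y\land x=x$, its natural preorder is $x\preceq y\iff x\land y\land x=x$, and Green's relation is $x\mathrel{\mathcal D}y\iff x\preceq y$ and $y\preceq x$. A *skew algebra* (skew Boolean algebra with intersections) is a skew lattice $A$ in which $\land$ distributes over $\lor$ on both sides, with an element $0$ neutral for $\lor$, an operation $\setminus$ satisfying $(x\setminus y)\land(x\land y\land x)=0$ and $(x\setminus y)\lor(x\land y\land x)=x$, and in which any two elements $x,y$ have a greatest lower bound $x\cap y$ for $\le$. It is *right-handed* if $x\land y\land x=y\land x$. Homomorphisms preserve $0,\land,\lor,\setminus,\cap$. A homomorphism $f:A\to A'$ is *$\mathcal D$-saturated* if its image is a union of $\mathcal D$-classes of $A'$. A *Boolean space* is a locally compact zero-dimensional Hausdorff space; *copen* means compact and open. A *skew Boolean space* is a surjective étale map (local homeomorphism) $p:E\to B$ between Boolean spaces. A *copen section* of $p$ is a copen $S\subseteq E$ on which $p$ is injective;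 it is *above* $p(S)$. A *morphism* $(g,h)$ from $p:E\to B$ to $p':E'\to B'$ consists of partial maps $g:E\rightharpoonup E'$ and $h:B\rightharpoonup B'$ with open domains, continuous on their domains and proper (preimages of compact sets are compact), such that whenever $g(y)$ is defined, so is $h(p(y))$, and $h(p(y))=p'(g(y))$, and such that for every $x\in\operatorname{dom}h$ the map $g$ restricts to a bijection from $p^{-1}(x)\cap\operatorname{dom}g$ onto $p'^{-1}(h(x))$. Morphisms compose as pairs of partial maps. For a skew Boolean space $p:E\to B$ write $\sigma_p(S)=p^{-1}(p(S))$. The copen sections of $p$ form a right-handed skew algebra $A_p$ with $0=\emptyset$, $S\land R=\sigma_p(S)\cap R$, $S\lor R=S\cup(R-\sigma_p(S))$, $S\setminus R=S-\sigma_p(R)$, and $S\cap R$ the set-theoretic intersection. A morphism $(g,h):p\to p'$ induces a homomorphism $A_{p'}\to A_p$, $S\mapsto g^{-1}(S)$. This defines a contravariant functor $\mathcal A$ from skew Boolean spaces to right-handed skew algebras. **Theorem.** The functor $\mathcal A$ is a duality (a contravariant equivalence) between the category of skew Boolean spaces and the category of right-handed skew algebras. Under it, the $\mathcal D$-saturated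 homomorphisms correspond to the morphisms with the following *lifting property*: a morphism $(g,h):p\to p'$ has it if for every copen $U\subseteq B'$ and every copen section $S$ of $p$ above $h^{-1}(U)$ there is a copen section $R$ of $p'$ above $U$ with $S=g^{-1}(R)$. That is, a morphism $(g,h)$ of skew Boolean spaces has the lifting property if and only if the homomorphism $\mathcal A(g,h)$ is $\mathcal D$-saturated. Moreover $\mathcal A$ restricts to a duality between the category of skew Boolean spaces and morphisms with the lifting property and the category of right-handed skew algebras and $\mathcal D$-saturated homomorphisms. -/

import Mathlib

open CategoryTheory

universe u

namespace SkewDuality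

/-! ## Skew Boolean algebras with intersections -/

/-- A skew lattice: two idempotent associative operations satisfying the absorption identities.
The operations are not assumed commutative; `⊓` and `⊔` are bare notation for them. -/
class SkewLattice (A : Type u) extends Min A, Max A where
  meet_idem : ∀ x : A, x ⊓ x = x
  join_idem : ∀ x : A, x ⊔ x = x
  meet_assoc : ∀ x y z : A, (x ⊓ y) ⊓ z = x ⊓ (y ⊓ z)
  join_assoc : ∀ x y z : A, (x ⊔ y) ⊔ z = x ⊔ (y ⊔ z)
  meet_join_absorb : ∀ x y : A, x ⊓ (x ⊔ y) = x
  join_meet_absorb : ∀ x y : A, (y ⊔ x) ⊓ x = x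
  join_meet_absorb' : ∀ x y : A, x ⊔ (x ⊓ y) = x
  meet_join_absorb' : ∀ x y : A, (y ⊓ x) ⊔ x = x

/-- The natural partial order of a skew lattice. -/
def NatLE {A : Type u} [SkewLattice A] (x y : A) : Prop :=
  x ⊓ y = x ∧ y ⊓ x = x

/-- The natural preorder of a skew lattice. -/
def NatPreLE {A : Type u} [SkewLattice A] (x y : A) : Prop :=
  (x ⊓ y) ⊓ x = x

/-- Green's relation `𝒟`: the equivalence relation of the natural preorder. -/
def GreenD {A : Type u} [SkewLattice A] (x y : A) : Prop :=
  NatPreLE x y ∧ NatPreLE y x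

/-- A skew Boolean algebra: a meet-distributive skew lattice with a zero that is neutral for the
join, and with a relative complement. -/
class SkewBooleanAlgebra (A : Type u) extends SkewLattice A, Zero A, SDiff A where
  meet_join_distrib : ∀ x y z : A, x ⊓ (y ⊔ z) = (x ⊓ y) ⊔ (x ⊓ z)
  join_meet_distrib : ∀ x y z : A, (y ⊔ z) ⊓ x = (y ⊓ x) ⊔ (z ⊓ x)
  zero_join : ∀ x : A, 0 ⊔ x = x
  join_zero : ∀ x : A, x ⊔ 0 = x
  sdiff_meet : ∀ x y : A, (x \ y) ⊓ ((x ⊓ y) ⊓ x) = 0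
  sdiff_join : ∀ x y : A, (x \ y) ⊔ ((x ⊓ y) ⊓ x) = x

/-- A skew algebra: a skew Boolean algebra in which any two elements have a greatest lower bound
`x ∩ y`, called their intersection, for the natural partial order. -/
class SkewAlgebra (A : Type u) extends SkewBooleanAlgebra A, Inter A where
  inter_le_left : ∀ x y : A, NatLE (x ∩ y) x
  inter_le_right : ∀ x y : A, NatLE (x ∩ y) y
  le_inter : ∀ x y z : A, NatLE z x → NatLE z y → NatLE z (x ∩ y)

/-- Homomorphisms of skew algebras preserve all the operations. -/
@[ext]
structure SkewHom (A B : Type u) [SkewAlgebra A] [SkewAlgebra B] where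
  toFun : A → B
  map_zero : toFun 0 = 0
  map_meet : ∀ x y, toFun (x ⊓ y) = toFun x ⊓ toFun y
  map_join : ∀ x y, toFun (x ⊔ y) = toFun x ⊔ toFun y
  map_sdiff : ∀ x y, toFun (x \ y) = toFun x \ toFun y
  map_inter : ∀ x y, toFun (x ∩ y) = toFun x ∩ toFun y

/-- A right-handed skew algebra. -/
structure RightHandedSkewAlgebra : Type (u + 1) where
  carrier : Type u
  [skewAlgebra : SkewAlgebra carrier]
  right_handed : ∀ x y : carrier, (x ⊓ y) ⊓ x = y ⊓ x

attribute [instance] RightHandedSkewAlgebra.skewAlgebra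

/-- The category of right-handed skew algebras and all homomorphisms of skew algebras. -/
instance : Category RightHandedSkewAlgebra.{u} where
  Hom A B := SkewHom A.carrier B.carrier
  id A := ⟨id, rfl, fun _ _ => rfl, fun _ _ => rfl, fun _ _ => rfl, fun _ _ => rfl⟩
  comp f g :=
    { toFun := g.toFun ∘ f.toFun
      map_zero := by simp [f.map_zero, g.map_zero]
      map_meet := by simp [f.map_meet, g.map_meet]
      map_join := by simp [f.map_join, g.map_join]
      map_sdiff := by simp [f.map_sdiff, g.map_sdiff]
      map_inter := by simp [f.map_inter, g.map_inter] }

/-- A homomorphism is `𝒟`-saturated when its image is saturated with respect to `𝒟`. -/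
def dSaturated : MorphismProperty RightHandedSkewAlgebra.{u} := fun _ _ f =>
  ∀ b ∈ Set.range f.toFun, ∀ c, GreenD b c → c ∈ Set.range f.toFun

theorem greenD_iff (A : RightHandedSkewAlgebra.{u}) (x y : A.carrier) :
    GreenD x y ↔ y ⊓ x = x ∧ x ⊓ y = y := by
  unfold GreenD NatPreLE
  rw [A.right_handed, A.right_handed]

instance : (dSaturated.{u}).IsMultiplicative where
  id_mem _ := fun _ _ c _ => ⟨c, rfl⟩
  comp_mem {A B C} f g hf hg := by
    rintro _ ⟨a, rfl⟩ c hc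
    obtain ⟨b, rfl⟩ := hg _ ⟨f.toFun a, rfl⟩ c hc
    -- replace `b` by an element of the `𝒟`-class of `f a` with the same image under `g`
    have key : GreenD (f.toFun a) ((f.toFun a ⊓ b) ⊔ f.toFun a) := by
      rw [greenD_iff]
      refine ⟨SkewLattice.join_meet_absorb _ _, ?_⟩
      rw [SkewBooleanAlgebra.meet_join_distrib, ← SkewLattice.meet_assoc,
        SkewLattice.meet_idem]
    obtain ⟨a', ha'⟩ := hf _ ⟨a, rfl⟩ _ key
    refine ⟨a', ?_⟩
    change g.toFun (f.toFun a') = g.toFun b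
    have h1 := (greenD_iff C _ _).1 hc
    change g.toFun b ⊓ g.toFun (f.toFun a) = g.toFun (f.toFun a) ∧
      g.toFun (f.toFun a) ⊓ g.toFun b = g.toFun b at h1
    rw [ha', g.map_join, g.map_meet, h1.2]
    have h2 := SkewLattice.join_meet_absorb' (g.toFun b) (g.toFun (f.toFun a))
    rwa [h1.1] at h2

/-! ## Skew Boolean spaces -/

/-- A Boolean space: a locally compact zero-dimensional Hausdorff space. -/
class BooleanSpace (X : Type u) [TopologicalSpace X] : Prop
    extends T2Space X, LocallyCompactSpace X where
  isTopologicalBasis_isClopen : TopologicalSpace.IsTopologicalBasis {s : Set X | IsClopen s}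

/-- A skew Boolean space: a surjective étale map (local homeomorphism) between Boolean spaces. -/
structure SkewBooleanSpace : Type (u + 1) where
  total : Type u
  base : Type u
  [topTotal : TopologicalSpace total]
  [topBase : TopologicalSpace base]
  [booleanTotal : BooleanSpace total]
  [booleanBase : BooleanSpace base]
  proj : total → base
  etale : IsLocalHomeomorph proj
  surj : Function.Surjective proj

attribute [instance] SkewBooleanSpace.topTotal SkewBooleanSpace.topBase
  SkewBooleanSpace.booleanTotal SkewBooleanSpace.booleanBase

/-- A partial map which has an open domain of definition, is continuous on its domain, and is
proper: preimages of compact sets are compact. -/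
structure IsProperPartial {X Y : Type u} [TopologicalSpace X] [TopologicalSpace Y]
    (f : X →. Y) : Prop where
  isOpen_dom : IsOpen f.Dom
  continuous : Continuous f.asSubtype
  proper : ∀ K : Set Y, IsCompact K → IsCompact (f.preimage K)

namespace IsProperPartial

variable {X Y Z : Type u} [TopologicalSpace X] [TopologicalSpace Y] [TopologicalSpace Z]

theorem isOpen_preimage {f : X →. Y} (hf : IsProperPartial f) {s : Set Y} (hs : IsOpen s) :
    IsOpen (f.preimage s) := by
  have h := hs.preimage hf.continuous
  rw [PFun.preimage_asSubtype] at h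
  have h2 := hf.isOpen_dom.isOpenMap_subtype_val _ h
  rw [Subtype.image_preimage_coe] at h2
  rwa [Set.inter_eq_right.2 (PFun.preimage_subset_dom f s)] at h2

theorem of_isOpen_preimage {f : X →. Y} (h : ∀ s, IsOpen s → IsOpen (f.preimage s))
    (h' : ∀ K : Set Y, IsCompact K → IsCompact (f.preimage K)) : IsProperPartial f where
  isOpen_dom := by simpa [PFun.preimage_univ] using h Set.univ isOpen_univ
  continuous := ⟨fun s hs => by
    rw [PFun.preimage_asSubtype]
    exact (h s hs).preimage continuous_subtype_val⟩
  proper := h'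

theorem preimage_id {X : Type u} (s : Set X) : (PFun.id X).preimage s = s := by
  ext x; simp [PFun.mem_preimage]

theorem id : IsProperPartial (PFun.id X) :=
  of_isOpen_preimage (fun s hs => by rwa [preimage_id]) (fun s hs => by rwa [preimage_id])

theorem comp {g : Y →. Z} {f : X →. Y} (hg : IsProperPartial g) (hf : IsProperPartial f) :
    IsProperPartial (g.comp f) :=
  of_isOpen_preimage
    (fun s hs => by rw [PFun.preimage_comp]; exact hf.isOpen_preimage (hg.isOpen_preimage hs))
    (fun s hs => by rw [PFun.preimage_comp]; exact hf.proper _ (hg.proper _ hs))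

end IsProperPartial

theorem mem_comp {X Y Z : Type u} (g : Y →. Z) (f : X →. Y) (x : X) (z : Z) :
    z ∈ g.comp f x ↔ ∃ y, y ∈ f x ∧ z ∈ g y := by
  rw [PFun.comp_apply]
  exact Part.mem_bind_iff.trans ⟨fun ⟨y, h, h'⟩ => ⟨y, h, h'⟩, fun ⟨y, h, h'⟩ => ⟨y, h, h'⟩⟩

/-- A morphism `(g, h)` of skew Boolean spaces from `p : E → B` to `p' : E' → B'`.

The square commutes in the sense of partial maps: where `g` is defined at `y`, also `h` is defined
at `p y`, with value `p' (g y)`. The domain of `g` may be smaller than `p ⁻¹ (dom h)`.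
The last condition together with `comm` says that for every `x` in the domain of `h`, the map `g`
restricts to a bijection from the part of the fibre of `p` over `x` on which `g` is defined onto
the fibre of `p'` over `h x`. -/
@[ext]
structure SkewBooleanSpace.Mor (p p' : SkewBooleanSpace.{u}) where
  g : p.total →. p'.total
  h : p.base →. p'.base
  g_proper : IsProperPartial g
  h_proper : IsProperPartial h
  comm : ∀ y, ∀ z ∈ g y, p'.proj z ∈ h (p.proj y)
  bij_fibres : ∀ x, ∀ x' ∈ h x, ∀ z, p'.proj z = x' → ∃! y, p.proj y = x ∧ z ∈ g y

/-- The category of skew Boolean spaces; composition is composition of partial maps. -/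
instance : Category SkewBooleanSpace.{u} where
  Hom := SkewBooleanSpace.Mor
  id p :=
    { g := PFun.id _
      h := PFun.id _
      g_proper := IsProperPartial.id
      h_proper := IsProperPartial.id
      comm := by
        intro y z hz
        have hz' : z = y := by simpa using hz
        subst hz'
        simp
      bij_fibres := by
        intro x x' hx z hz
        have hx' : x' = x := by simpa using hx
        subst hx'
        exact ⟨z, ⟨hz, by simp⟩, fun y hy => by
          have h2 : z = y := by simpa using hy.2
          exact h2.symm⟩ }
  comp {p p' p''} m n :=
    { g := n.g.comp m.g
      h := n.h.comp m.h
      g_proper := n.g_proper.comp m.g_proper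
      h_proper := n.h_proper.comp m.h_proper
      comm := by
        intro y z hz
        rw [mem_comp] at hz ⊢
        obtain ⟨w, hw, hz⟩ := hz
        exact ⟨_, m.comm y w hw, n.comm w z hz⟩
      bij_fibres := by
        intro x x'' hx z hz
        rw [mem_comp] at hx
        obtain ⟨x', hx', hx''⟩ := hx
        obtain ⟨w, ⟨hw1, hw2⟩, hw3⟩ := n.bij_fibres x' x'' hx'' z hz
        obtain ⟨y, ⟨hy1, hy2⟩, hy3⟩ := m.bij_fibres x x' hx' w hw1
        refine ⟨y, ⟨hy1, (mem_comp _ _ _ _).2 ⟨w, hy2, hw2⟩⟩, ?_⟩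
        rintro y' ⟨hy1', hy2'⟩
        rw [mem_comp] at hy2'
        obtain ⟨w', hw', hz'⟩ := hy2'
        have h1 := m.comm _ _ hw'
        rw [hy1'] at h1
        have h2 : w' = w := hw3 w' ⟨Part.mem_unique h1 hx', hz'⟩
        subst h2
        exact hy3 y' ⟨hy1', hw'⟩ }
  id_comp m := SkewBooleanSpace.Mor.ext (PFun.comp_id _) (PFun.comp_id _)
  comp_id m := SkewBooleanSpace.Mor.ext (PFun.id_comp _) (PFun.id_comp _)
  assoc m n k := SkewBooleanSpace.Mor.ext (PFun.comp_assoc _ _ _).symm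
    (PFun.comp_assoc _ _ _).symm

/-! ## The skew algebra of copen sections -/

/-- A copen section of `p : E → B`: a compact open subset of `E` on which `p` is injective. -/
@[ext]
structure CopenSection (p : SkewBooleanSpace.{u}) where
  carrier : Set p.total
  isOpen : IsOpen carrier
  isCompact : IsCompact carrier
  injOn : Set.InjOn p.proj carrier

/-- The saturation `p ⁻¹ (p S)` of a subset `S` of the total space. -/
def saturation (p : SkewBooleanSpace.{u}) (S : Set p.total) : Set p.total :=
  p.proj ⁻¹' (p.proj '' S)

section saturation

variable {p : SkewBooleanSpace.{u}}

theorem subset_saturation (S : Set p.total) : S ⊆ saturation p S :=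
  Set.subset_preimage_image _ _

theorem mem_saturation {S : Set p.total} {x : p.total} :
    x ∈ saturation p S ↔ ∃ s ∈ S, p.proj s = p.proj x := Iff.rfl

theorem saturation_inter (S R : Set p.total) :
    saturation p (saturation p S ∩ R) = saturation p S ∩ saturation p R := by
  ext x
  constructor
  · rintro ⟨r, ⟨⟨s, hs, h1⟩, hr⟩, h2⟩
    exact ⟨⟨s, hs, h1.trans h2⟩, r, hr, h2⟩
  · rintro ⟨⟨s, hs, h1⟩, r, hr, h2⟩
    exact ⟨r, ⟨⟨s, hs, h1.trans h2.symm⟩, hr⟩, h2⟩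

theorem saturation_union (S R : Set p.total) :
    saturation p (S ∪ (R \ saturation p S)) = saturation p S ∪ saturation p R := by
  ext x
  constructor
  · rintro ⟨r, hr | hr, h2⟩
    · exact Or.inl ⟨r, hr, h2⟩
    · exact Or.inr ⟨r, hr.1, h2⟩
  · rintro (⟨s, hs, h1⟩ | ⟨r, hr, h2⟩)
    · exact ⟨s, Or.inl hs, h1⟩
    · by_cases h : r ∈ saturation p S
      · obtain ⟨s, hs, h1⟩ := h
        exact ⟨s, Or.inl hs, h1.trans h2⟩
      · exact ⟨r, Or.inr ⟨hr, h⟩, h2⟩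

theorem CopenSection.isClopen_saturation (S : CopenSection p) :
    IsClopen (saturation p S.carrier) :=
  ⟨(S.isCompact.image p.etale.continuous).isClosed.preimage p.etale.continuous,
    (p.etale.isOpenMap _ S.isOpen).preimage p.etale.continuous⟩

end saturation

variable {p : SkewBooleanSpace.{u}}

instance : Zero (CopenSection p) := ⟨⟨∅, isOpen_empty, isCompact_empty, by simp⟩⟩

instance : Min (CopenSection p) := ⟨fun S R =>
  { carrier := saturation p S.carrier ∩ R.carrier
    isOpen := S.isClopen_saturation.isOpen.inter R.isOpen
    isCompact := R.isCompact.inter_left S.isClopen_saturation.isClosed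
    injOn := R.injOn.mono Set.inter_subset_right }⟩

instance : Max (CopenSection p) := ⟨fun S R =>
  { carrier := S.carrier ∪ (R.carrier \ saturation p S.carrier)
    isOpen := S.isOpen.union (R.isOpen.sdiff S.isClopen_saturation.isClosed)
    isCompact := S.isCompact.union (R.isCompact.diff S.isClopen_saturation.isOpen)
    injOn := by
      rintro x (hx | hx) y (hy | hy) h
      · exact S.injOn hx hy h
      · exact absurd ⟨x, hx, h⟩ hy.2
      · exact absurd ⟨y, hy, h.symm⟩ hx.2
      · exact R.injOn hx.1 hy.1 h }⟩

instance : SDiff (CopenSection p) := ⟨fun S R =>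
  { carrier := S.carrier \ saturation p R.carrier
    isOpen := S.isOpen.sdiff R.isClopen_saturation.isClosed
    isCompact := S.isCompact.diff R.isClopen_saturation.isOpen
    injOn := S.injOn.mono Set.sdiff_subset }⟩

instance : Inter (CopenSection p) := ⟨fun S R =>
  { carrier := S.carrier ∩ R.carrier
    isOpen := S.isOpen.inter R.isOpen
    isCompact := S.isCompact.inter R.isCompact
    injOn := S.injOn.mono Set.inter_subset_left }⟩

theorem carrier_zero : (0 : CopenSection p).carrier = ∅ := rfl

theorem carrier_meet (S R : CopenSection p) :
    (S ⊓ R).carrier = saturation p S.carrier ∩ R.carrier := rfl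

theorem carrier_join (S R : CopenSection p) :
    (S ⊔ R).carrier = S.carrier ∪ (R.carrier \ saturation p S.carrier) := rfl

theorem carrier_sdiff (S R : CopenSection p) :
    (S \ R).carrier = S.carrier \ saturation p R.carrier := rfl

theorem carrier_inter (S R : CopenSection p) :
    (S ∩ R).carrier = S.carrier ∩ R.carrier := rfl

instance : SkewLattice (CopenSection p) where
  meet_idem x := by
    ext a
    have := @subset_saturation p x.carrier a
    simp only [carrier_meet, Set.mem_inter_iff]; tauto
  join_idem x := by
    ext a
    have := @subset_saturation p x.carrier a
    simp only [carrier_join, Set.mem_union, Set.mem_sdiff]; tauto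
  meet_assoc x y z := by
    ext a
    simp only [carrier_meet, saturation_inter, Set.mem_inter_iff]; tauto
  join_assoc x y z := by
    ext a
    simp only [carrier_join, saturation_union, Set.mem_union, Set.mem_sdiff]; tauto
  meet_join_absorb x y := by
    ext a
    have := @subset_saturation p x.carrier a
    simp only [carrier_meet, carrier_join, Set.mem_inter_iff, Set.mem_union, Set.mem_sdiff]
    tauto
  join_meet_absorb x y := by
    ext a
    have := @subset_saturation p x.carrier a
    simp only [carrier_meet, carrier_join, saturation_union, Set.mem_inter_iff, Set.mem_union]
    tauto
  join_meet_absorb' x y := by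
    ext a
    simp only [carrier_meet, carrier_join, Set.mem_inter_iff, Set.mem_union, Set.mem_sdiff]
    tauto
  meet_join_absorb' x y := by
    ext a
    have := @subset_saturation p x.carrier a
    simp only [carrier_meet, carrier_join, saturation_inter, Set.mem_inter_iff, Set.mem_union,
      Set.mem_sdiff]
    tauto

theorem natLE_iff (x y : CopenSection p) : NatLE x y ↔ x.carrier ⊆ y.carrier := by
  constructor
  · rintro ⟨h, -⟩ a ha
    rw [← h] at ha
    exact ha.2
  · intro h
    constructor
    · ext a
      constructor
      · rintro ⟨⟨b, hb, hab⟩, ha⟩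
        exact y.injOn (h hb) ha hab ▸ hb
      · intro ha
        exact ⟨subset_saturation _ ha, h ha⟩
    · ext a
      exact ⟨fun ha => ha.2, fun ha => ⟨subset_saturation _ (h ha), ha⟩⟩

theorem saturation_sdiff (S R : Set p.total) :
    saturation p (S \ saturation p R) = saturation p S \ saturation p R := by
  ext x
  constructor
  · rintro ⟨s, ⟨hs, h1⟩, h2⟩
    exact ⟨⟨s, hs, h2⟩, fun ⟨r, hr, h3⟩ => h1 ⟨r, hr, h3.trans h2.symm⟩⟩
  · rintro ⟨⟨s, hs, h1⟩, h2⟩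
    exact ⟨s, ⟨hs, fun ⟨r, hr, h3⟩ => h2 ⟨r, hr, h3.trans h1⟩⟩, h1⟩

instance : SkewAlgebra (CopenSection p) where
  meet_join_distrib x y z := by
    ext a
    simp only [carrier_meet, carrier_join, saturation_inter, Set.mem_inter_iff, Set.mem_union,
      Set.mem_sdiff]
    tauto
  join_meet_distrib x y z := by
    ext a
    have := @subset_saturation p x.carrier a
    simp only [carrier_meet, carrier_join, saturation_inter, saturation_union,
      Set.mem_inter_iff, Set.mem_union, Set.mem_sdiff]
    tauto
  zero_join x := by
    ext a
    simp [carrier_join, carrier_zero, saturation]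
  join_zero x := by
    ext a
    simp [carrier_join, carrier_zero]
  sdiff_meet x y := by
    ext a
    simp only [carrier_meet, carrier_sdiff, carrier_zero, saturation_inter, saturation_sdiff,
      Set.mem_inter_iff, Set.mem_sdiff, Set.mem_empty_iff_false]
    tauto
  sdiff_join x y := by
    ext a
    have := @subset_saturation p x.carrier a
    simp only [carrier_meet, carrier_join, carrier_sdiff, saturation_inter, saturation_sdiff,
      Set.mem_inter_iff, Set.mem_union, Set.mem_sdiff]
    tauto
  inter_le_left x y := (natLE_iff _ _).2 Set.inter_subset_left
  inter_le_right x y := (natLE_iff _ _).2 Set.inter_subset_right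
  le_inter x y z h1 h2 :=
    (natLE_iff _ _).2 (Set.subset_inter ((natLE_iff _ _).1 h1) ((natLE_iff _ _).1 h2))

theorem right_handed (x y : CopenSection p) : (x ⊓ y) ⊓ x = y ⊓ x := by
  ext a
  have := @subset_saturation p x.carrier a
  simp only [carrier_meet, saturation_inter, Set.mem_inter_iff]
  tauto

/-! ## The duality functor -/

variable {p' : SkewBooleanSpace.{u}}

/-- The preimage of a copen section under a morphism of skew Boolean spaces. -/
def CopenSection.pullback (m : p ⟶ p') (S : CopenSection p') : CopenSection p where
  carrier := m.g.preimage S.carrier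
  isOpen := m.g_proper.isOpen_preimage S.isOpen
  isCompact := m.g_proper.proper _ S.isCompact
  injOn := by
    rintro y ⟨z, hz, hyz⟩ y' ⟨z', hz', hyz'⟩ h
    replace hyz : z ∈ m.g y := hyz
    replace hyz' : z' ∈ m.g y' := hyz'
    have h1 := m.comm _ _ hyz
    have h2 := m.comm _ _ hyz'
    rw [h] at h1
    have h3 : z = z' := S.injOn hz hz' (Part.mem_unique h1 h2)
    subst h3
    exact (m.bij_fibres _ _ h2 z rfl).unique ⟨h, hyz⟩ ⟨rfl, hyz'⟩

/-- Where `g` is defined, taking preimages commutes with saturation. -/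
theorem mem_saturation_preimage (m : p ⟶ p') (S : Set p'.total) {y : p.total} {z : p'.total}
    (hz : z ∈ m.g y) :
    y ∈ saturation p (m.g.preimage S) ↔ z ∈ saturation p' S := by
  have h := m.comm _ _ hz
  constructor
  · rintro ⟨y', ⟨z', hz', hyz'⟩, h'⟩
    have h2 := m.comm y' z' hyz'
    rw [h'] at h2
    exact ⟨z', hz', Part.mem_unique h2 h⟩
  · rintro ⟨s, hs, h'⟩
    obtain ⟨y', ⟨h1, h2⟩, -⟩ := m.bij_fibres _ _ h s h'
    exact ⟨y', ⟨s, hs, h2⟩, h1⟩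

theorem pullback_ext (m : p ⟶ p') {S : CopenSection p} {R : CopenSection p'}
    (h1 : S.carrier ⊆ m.g.Dom)
    (h2 : ∀ y, ∀ z ∈ m.g y, (z ∈ R.carrier ↔ y ∈ S.carrier)) : R.pullback m = S := by
  ext y
  constructor
  · rintro ⟨z, hz, hyz⟩
    exact (h2 y z hyz).1 hz
  · intro hy
    obtain ⟨z, hz⟩ := (PFun.mem_dom _ _).1 (h1 hy)
    exact ⟨z, (h2 y z hz).2 hy, hz⟩

theorem mem_pullback (m : p ⟶ p') (S : CopenSection p') {y : p.total} {z : p'.total}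
    (hz : z ∈ m.g y) : y ∈ (S.pullback m).carrier ↔ z ∈ S.carrier :=
  ⟨fun ⟨_, h1, h2⟩ => Part.mem_unique h2 hz ▸ h1, fun h => ⟨z, h, hz⟩⟩

theorem mem_saturation_pullback (m : p ⟶ p') (S : CopenSection p') {y : p.total} {z : p'.total}
    (hz : z ∈ m.g y) :
    y ∈ saturation p (S.pullback m).carrier ↔ z ∈ saturation p' S.carrier :=
  mem_saturation_preimage m _ hz

theorem pullback_subset_dom (m : p ⟶ p') (S : CopenSection p') :
    (S.pullback m).carrier ⊆ m.g.Dom := PFun.preimage_subset_dom _ _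

/-- Taking preimages under a morphism is a homomorphism between algebras of copen sections. -/
def pullbackHom (m : p ⟶ p') : SkewHom (CopenSection p') (CopenSection p) where
  toFun := CopenSection.pullback m
  map_zero := pullback_ext m (Set.empty_subset _) fun _ _ _ => Iff.rfl
  map_meet S R := pullback_ext m (Set.inter_subset_right.trans (pullback_subset_dom m R))
    fun y z hz => by
      simp only [carrier_meet, Set.mem_inter_iff, mem_pullback m _ hz,
        mem_saturation_pullback m _ hz]
  map_join S R := pullback_ext m (Set.union_subset (pullback_subset_dom m S)
    (Set.sdiff_subset.trans (pullback_subset_dom m R)))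
    fun y z hz => by
      simp only [carrier_join, Set.mem_union, Set.mem_sdiff, mem_pullback m _ hz,
        mem_saturation_pullback m _ hz]
  map_sdiff S R := pullback_ext m (Set.sdiff_subset.trans (pullback_subset_dom m S))
    fun y z hz => by
      simp only [carrier_sdiff, Set.mem_sdiff, mem_pullback m _ hz,
        mem_saturation_pullback m _ hz]
  map_inter S R := pullback_ext m (Set.inter_subset_left.trans (pullback_subset_dom m S))
    fun y z hz => by
      simp only [carrier_inter, Set.mem_inter_iff, mem_pullback m _ hz]

/-- The contravariant functor of the right-handed duality: it sends a skew Boolean space to its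
right-handed skew algebra of copen sections, and a morphism `(g, h)` to `S ↦ g ⁻¹ S`. -/
def copenSections : SkewBooleanSpace.{u}ᵒᵖ ⥤ RightHandedSkewAlgebra.{u} where
  obj p := { carrier := CopenSection p.unop, right_handed := right_handed }
  map m := pullbackHom m.unop
  map_id _ := SkewHom.ext (funext fun _ => CopenSection.ext (IsProperPartial.preimage_id _))
  map_comp _ _ := SkewHom.ext (funext fun _ => CopenSection.ext (PFun.preimage_comp _ _ _))

/-! ## The lifting property -/

/-- The lifting property of a morphism `(g, h) : p ⟶ p'`: for every copen `U` in the base of `p'`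
and every copen section `S` of `p` above `h ⁻¹ U` there is a copen section `R` of `p'` above `U`
with `S = g ⁻¹ R`. -/
def lifting : MorphismProperty SkewBooleanSpace.{u} := fun p p' m =>
  ∀ U : Set p'.base, IsOpen U → IsCompact U →
    ∀ S : CopenSection p, p.proj '' S.carrier = m.h.preimage U →
      ∃ R : CopenSection p', p'.proj '' R.carrier = U ∧ S.carrier = m.g.preimage R.carrier

instance : (lifting.{u}).IsMultiplicative where
  id_mem _ := fun _ _ _ S hS => ⟨S, by
    rw [hS]; exact IsProperPartial.preimage_id _, (IsProperPartial.preimage_id _).symm⟩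
  comp_mem {p _ _} m n hm hn := by
    intro U hU hU' S hS
    have hS' : p.proj '' S.carrier = m.h.preimage (n.h.preimage U) :=
      hS.trans (PFun.preimage_comp _ _ _)
    obtain ⟨R, hR, hR'⟩ := hm _ (n.h_proper.isOpen_preimage hU) (n.h_proper.proper _ hU') S hS'
    obtain ⟨T, hT, hT'⟩ := hn U hU hU' R hR
    refine ⟨T, hT, ?_⟩
    rw [hR', hT']
    exact (PFun.preimage_comp _ _ _).symm

end SkewDuality

namespace SkewDuality

/-! ## Right-handed skew algebras -/

section Algebra

open SkewLattice SkewBooleanAlgebra SkewAlgebra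

variable {A : RightHandedSkewAlgebra.{u}} {a b c d x y : A.carrier}

theorem zero_meet (x : A.carrier) : 0 ⊓ x = 0 := by
  simpa only [zero_join] using meet_join_absorb 0 x

theorem meet_zero (x : A.carrier) : x ⊓ 0 = 0 := by
  simpa only [join_zero] using join_meet_absorb 0 x

theorem meet_meet_self (x y : A.carrier) : x ⊓ (y ⊓ x) = y ⊓ x := by
  rw [← meet_assoc, A.right_handed]

theorem meet_idem_left (x y : A.carrier) : x ⊓ (x ⊓ y) = x ⊓ y := by
  rw [← meet_assoc, meet_idem]

theorem natLE_iff_meet_eq : NatLE x y ↔ x ⊓ y = x := by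
  refine ⟨fun h => h.1, fun h => ⟨h, ?_⟩⟩
  have := meet_meet_self y x
  rwa [h] at this

theorem natLE_refl (x : A.carrier) : NatLE x x := ⟨meet_idem x, meet_idem x⟩

theorem NatLE.antisymm (h : NatLE x y) (h' : NatLE y x) : x = y :=
  h.1.symm.trans h'.2

theorem NatLE.trans (h : NatLE x y) (h' : NatLE y a) : NatLE x a := by
  rw [natLE_iff_meet_eq]
  conv_lhs => rw [← h.1, meet_assoc, h'.1]
  exact h.1

theorem zero_natLE (x : A.carrier) : NatLE 0 x := ⟨zero_meet x, meet_zero x⟩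

theorem meet_natLE_right (x y : A.carrier) : NatLE (x ⊓ y) y := by
  rw [natLE_iff_meet_eq, meet_assoc, meet_idem]

theorem sdiff_meet_of_natLE (h : NatLE x a) : (a \ x) ⊓ x = 0 := by
  simpa only [h.2, h.1] using sdiff_meet a x

theorem sdiff_join_of_natLE (h : NatLE x a) : (a \ x) ⊔ x = a := by
  simpa only [h.2, h.1] using sdiff_join a x

/-- In a principal ideal, elements in the same `𝒟`-class coincide. -/
theorem eq_of_natLE_of_greenD (hx : NatLE x a) (hy : NatLE y a) (h : GreenD x y) : x = y := by
  obtain ⟨h1, h2⟩ := (greenD_iff A x y).1 h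
  have h3 : (a \ x) ⊓ y = 0 := by
    rw [← h2, ← meet_assoc, sdiff_meet_of_natLE hx, zero_meet]
  have h4 : y ⊓ (a \ x) = 0 := by
    rw [← meet_meet_self, ← meet_assoc, h3, zero_meet]
  calc x = y ⊓ ((a \ x) ⊔ x) := by rw [meet_join_distrib, h4, zero_join, h1]
    _ = y := by rw [sdiff_join_of_natLE hx, hy.1]

/-- A right-handed skew algebra is right normal. -/
theorem meet_left_comm (x y z : A.carrier) : x ⊓ (y ⊓ z) = y ⊓ (x ⊓ z) := by
  have key : ∀ x y : A.carrier, (x ⊓ (y ⊓ z)) ⊓ (y ⊓ (x ⊓ z)) = y ⊓ (x ⊓ z) := by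
    intro x y
    calc (x ⊓ (y ⊓ z)) ⊓ (y ⊓ (x ⊓ z)) = x ⊓ (y ⊓ (z ⊓ ((y ⊓ x) ⊓ z))) := by
          simp only [meet_assoc]
      _ = x ⊓ (y ⊓ (x ⊓ z)) := by
          rw [meet_meet_self, meet_assoc y x z, meet_idem_left]
      _ = ((x ⊓ y) ⊓ x) ⊓ z := by simp only [meet_assoc]
      _ = y ⊓ (x ⊓ z) := by rw [A.right_handed, meet_assoc]
  refine eq_of_natLE_of_greenD (a := z) ?_ ?_ ((greenD_iff A _ _).2 ⟨key y x, key x y⟩) <;>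
    rw [← meet_assoc] <;> exact meet_natLE_right _ _

theorem meet_comm_of_natLE (hx : NatLE x a) (hy : NatLE y a) : x ⊓ y = y ⊓ x := by
  rw [← hy.1, meet_left_comm, hx.1, hy.1]

/-- A lower bound of `y` which is below `z` in the natural preorder is below `z ⊓ y`. -/
theorem natLE_meet (h : NatLE x y) (h' : z ⊓ x = x) : NatLE x (z ⊓ y) := by
  rw [natLE_iff_meet_eq, meet_left_comm, h.1, h']

theorem sdiff_natLE (x y : A.carrier) : NatLE (x \ y) x := by
  rw [natLE_iff_meet_eq]
  simpa only [sdiff_join] using meet_join_absorb (x \ y) ((x ⊓ y) ⊓ x)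

theorem sdiff_meet_eq_zero (x y : A.carrier) : (x \ y) ⊓ y = 0 := by
  have h := sdiff_meet x y
  rw [A.right_handed, meet_left_comm, (sdiff_natLE x y).1] at h
  rw [← meet_meet_self, ← meet_assoc, h, zero_meet]

theorem sdiff_join_meet (x y : A.carrier) : (x \ y) ⊔ (y ⊓ x) = x := by
  rw [← A.right_handed, sdiff_join]

theorem inter_eq_left (h : NatLE x y) : x ∩ y = x :=
  (inter_le_left x y).antisymm (le_inter _ _ _ (natLE_refl x) h)

theorem inter_eq_right (h : NatLE y x) : x ∩ y = y :=
  (inter_le_right x y).antisymm (le_inter _ _ _ h (natLE_refl y))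

theorem inter_eq_meet (hx : NatLE x a) (hy : NatLE y a) : x ∩ y = x ⊓ y := by
  refine NatLE.antisymm ?_ (le_inter _ _ _ ?_ (meet_natLE_right x y))
  · exact natLE_meet (inter_le_right x y) (inter_le_left x y).2
  · rw [meet_comm_of_natLE hx hy]
    exact meet_natLE_right y x

theorem inter_inter_distrib (a b c : A.carrier) : a ∩ (b ∩ c) = (a ∩ b) ⊓ (a ∩ c) := by
  rw [← inter_eq_meet (inter_le_left a b) (inter_le_left a c)]
  refine NatLE.antisymm (le_inter _ _ _ (le_inter _ _ _ ?_ ?_) (le_inter _ _ _ ?_ ?_))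
    (le_inter _ _ _ ?_ (le_inter _ _ _ ?_ ?_))
  · exact inter_le_left _ _
  · exact (inter_le_right _ _).trans (inter_le_left _ _)
  · exact inter_le_left _ _
  · exact (inter_le_right _ _).trans (inter_le_right _ _)
  · exact (inter_le_left _ _).trans (inter_le_left _ _)
  · exact (inter_le_left _ _).trans (inter_le_right _ _)
  · exact (inter_le_right _ _).trans (inter_le_right _ _)

/-- An element below both `x \ y` and `y` vanishes. -/
theorem eq_zero_of_natLE_sdiff (h : NatLE d (x \ y)) (h' : y ⊓ d = d) : d = 0 := by
  rw [← h.2, ← h', ← meet_assoc, sdiff_meet_eq_zero, zero_meet]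

theorem inter_sdiff_natLE (a b c : A.carrier) :
    NatLE ((a ∩ b) \ (a ∩ c)) (b \ (b ∩ c)) := by
  have hu : NatLE ((a ∩ b) \ (a ∩ c)) (a ∩ b) := sdiff_natLE _ _
  have hb := hu.trans (inter_le_right a b)
  have hd : ((a ∩ b) \ (a ∩ c)) ⊓ (b ∩ c) = 0 := by
    have h1 : NatLE (((a ∩ b) \ (a ∩ c)) ⊓ (b ∩ c)) ((a ∩ b) \ (a ∩ c)) := by
      rw [meet_comm_of_natLE hb (inter_le_left b c)]
      exact meet_natLE_right _ _
    exact eq_zero_of_natLE_sdiff h1 (le_inter _ _ _ (h1.trans (hu.trans (inter_le_left a b)))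
      ((meet_natLE_right _ _).trans (inter_le_right b c))).2
  rw [natLE_iff_meet_eq]
  have h := meet_join_distrib ((a ∩ b) \ (a ∩ c)) (b \ (b ∩ c)) (b ∩ c)
  rw [sdiff_join_of_natLE (inter_le_left b c), hd, join_zero, hb.1] at h
  exact h.symm

theorem sdiff_meet_join (a b : A.carrier) : (b \ a) ⊓ (a ⊔ b) = b \ a := by
  rw [meet_join_distrib, sdiff_meet_eq_zero, zero_join, (sdiff_natLE b a).1]

/-- A nonzero element lies in a maximal set which is closed under meets and avoids zero. -/
theorem exists_maximal_meetClosed (hc : c ≠ 0) : ∃ F : Set A.carrier, c ∈ F ∧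
    (∀ x ∈ F, ∀ y ∈ F, x ⊓ y ∈ F) ∧ ∀ x, x ∈ F ↔ ∀ f ∈ F, x ⊓ f ≠ 0 := by
  obtain ⟨F, hcF, hF⟩ := zorn_subset_nonempty
    {F : Set A.carrier | (∀ x ∈ F, ∀ y ∈ F, x ⊓ y ∈ F) ∧ (0 : A.carrier) ∉ F} (by
      intro C hC hchain _
      refine ⟨⋃₀ C, ⟨?_, ?_⟩, fun s hs => Set.subset_sUnion_of_mem hs⟩
      · rintro x ⟨s, hs, hx⟩ y ⟨t, ht, hy⟩
        obtain h | h := hchain.total hs ht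
        · exact ⟨t, ht, (hC ht).1 x (h hx) y hy⟩
        · exact ⟨s, hs, (hC hs).1 x hx y (h hy)⟩
      · rintro ⟨s, hs, h0⟩
        exact (hC hs).2 h0) {c} ⟨by simp [meet_idem], by simpa using hc.symm⟩
  have hcF : c ∈ F := hcF rfl
  obtain ⟨⟨hmeet, h0⟩, hmax⟩ := hF
  refine ⟨F, hcF, hmeet, fun x => ⟨fun hx f hf h => h0 (h ▸ hmeet x hx f hf), fun hx => ?_⟩⟩
  refine @hmax {z | ∃ f ∈ F, z ⊓ (x ⊓ f) = x ⊓ f} ⟨?_, ?_⟩ ?_ x ?_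
  · rintro z ⟨f, hf, hz⟩ w ⟨g, hg, hw⟩
    refine ⟨f ⊓ g, hmeet f hf g hg, ?_⟩
    have hz' : z ⊓ (x ⊓ (f ⊓ g)) = x ⊓ (f ⊓ g) := by
      simpa only [meet_assoc] using congrArg (· ⊓ g) hz
    have hw' : w ⊓ (x ⊓ (f ⊓ g)) = x ⊓ (f ⊓ g) := by
      rw [meet_left_comm x f g, meet_left_comm w f, hw]
    rw [meet_assoc, hw', hz']
  · rintro ⟨f, hf, h⟩
    rw [zero_meet] at h
    exact hx f hf h.symm
  · intro f hf
    exact ⟨f, hf, by rw [meet_left_comm, meet_idem]⟩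
  · exact ⟨c, hcF, meet_idem_left x c⟩

end Algebra

/-! ## The spectrum of a right-handed skew algebra -/

/-- Nonzero Boolean-valued functions satisfying a closed condition. -/
abbrev NonzeroPoints {α : Type u} (Q : Set (α → Bool)) : Type u :=
  {χ : α → Bool // χ ∈ Q ∧ ∃ a, χ a = true}

theorem isOpen_setOf_apply {α : Type u} (a : α) : IsOpen {χ : α → Bool | χ a = true} :=
  (isOpen_discrete {true}).preimage
    (continuous_apply a : Continuous fun χ : α → Bool => χ a)

theorem isClosed_setOf_apply {α : Type u} (a : α) : IsClosed {χ : α → Bool | χ a = true} :=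
  (isClosed_discrete {true}).preimage
    (continuous_apply a : Continuous fun χ : α → Bool => χ a)

theorem isOpen_setOf_nonzero {α : Type u} : IsOpen {χ : α → Bool | ∃ a, χ a = true} := by
  simp only [Set.ofPred_exists]
  exact isOpen_iUnion isOpen_setOf_apply

theorem booleanSpace_nonzeroPoints {α : Type u} {Q : Set (α → Bool)} (hQ : IsClosed Q) :
    BooleanSpace (NonzeroPoints Q) := by
  have : LocallyCompactSpace (NonzeroPoints Q) :=
    (hQ.isLocallyClosed.inter isOpen_setOf_nonzero.isLocallyClosed).locallyCompactSpace
  exact { isTopologicalBasis_isClopen := loc_compact_Haus_tot_disc_of_zero_dim }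

theorem isCompact_nonzeroPoints {α : Type u} {Q : Set (α → Bool)} (hQ : IsClosed Q) (a : α) :
    IsCompact {χ : NonzeroPoints Q | χ.1 a = true} := by
  rw [Subtype.isCompact_iff]
  refine (hQ.inter (isClosed_setOf_apply a)).isCompact.of_isClosed_subset ?_ ?_
  · convert hQ.inter (isClosed_setOf_apply a) using 1
    ext χ
    constructor
    · rintro ⟨χ, h, rfl⟩
      exact ⟨χ.2.1, h⟩
    · rintro ⟨h, h'⟩
      exact ⟨⟨χ, h, a, h'⟩, h', rfl⟩
  · rintro _ ⟨χ, h, rfl⟩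
    exact ⟨χ.2.1, h⟩

/-- A condition on finitely many values of a Boolean-valued function is closed. -/
theorem isClosed_setOf_apply₃ {α : Type u} (a b c : α) (R : Bool → Bool → Bool → Prop) :
    IsClosed {χ : α → Bool | R (χ a) (χ b) (χ c)} :=
  (isClosed_discrete {t : Bool × Bool × Bool | R t.1 t.2.1 t.2.2}).preimage
    (by fun_prop : Continuous fun χ : α → Bool => (χ a, χ b, χ c))

section Spectrum

open SkewLattice SkewBooleanAlgebra SkewAlgebra

variable {A : RightHandedSkewAlgebra.{u}} {a b c : A.carrier} {χ : A.carrier → Bool}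

/-- The condition defining the points of the base: the function preserves the operations
other than the intersection. -/
structure IsBasePoint (χ : A.carrier → Bool) : Prop where
  meet : ∀ a b, χ (a ⊓ b) = true ↔ χ a = true ∧ χ b = true
  join : ∀ a b, χ (a ⊔ b) = true ↔ χ a = true ∨ χ b = true
  sdiff : ∀ a b, χ (a \ b) = true ↔ χ a = true ∧ ¬ χ b = true

/-- The condition defining the points of the total space: the function is the indicator of an
ultrafilter for the natural partial order, or vanishes. -/
structure IsTotalPoint (χ : A.carrier → Bool) : Prop where
  zero : ¬ χ 0 = true
  inter : ∀ a b, χ (a ∩ b) = true ↔ χ a = true ∧ χ b = true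
  sdiff : ∀ a b, χ a = true → ¬ χ b = true → χ (a \ (a ∩ b)) = true

theorem isClosed_isBasePoint : IsClosed {χ : A.carrier → Bool | IsBasePoint χ} := by
  have : {χ : A.carrier → Bool | IsBasePoint χ} =
      (⋂ (a) (b), {χ | χ (a ⊓ b) = true ↔ χ a = true ∧ χ b = true}) ∩
      (⋂ (a) (b), {χ | χ (a ⊔ b) = true ↔ χ a = true ∨ χ b = true}) ∩
      ⋂ (a) (b), {χ | χ (a \ b) = true ↔ χ a = true ∧ ¬ χ b = true} := by
    ext χ
    simp only [Set.mem_inter_iff, Set.mem_iInter, Set.mem_ofPred_eq]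
    exact ⟨fun h => ⟨⟨h.meet, h.join⟩, h.sdiff⟩, fun h => ⟨h.1.1, h.1.2, h.2⟩⟩
  rw [this]
  refine ((isClosed_iInter fun a => isClosed_iInter fun b => ?_).inter
    (isClosed_iInter fun a => isClosed_iInter fun b => ?_)).inter
    (isClosed_iInter fun a => isClosed_iInter fun b => ?_)
  · exact isClosed_setOf_apply₃ (a ⊓ b) a b fun x y z => x = true ↔ y = true ∧ z = true
  · exact isClosed_setOf_apply₃ (a ⊔ b) a b fun x y z => x = true ↔ y = true ∨ z = true
  · exact isClosed_setOf_apply₃ (a \ b) a b fun x y z => x = true ↔ y = true ∧ ¬ z = true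

theorem isClosed_isTotalPoint : IsClosed {χ : A.carrier → Bool | IsTotalPoint χ} := by
  have : {χ : A.carrier → Bool | IsTotalPoint χ} =
      {χ | ¬ χ 0 = true} ∩
      (⋂ (a) (b), {χ | χ (a ∩ b) = true ↔ χ a = true ∧ χ b = true}) ∩
      ⋂ (a) (b), {χ | χ a = true → ¬ χ b = true → χ (a \ (a ∩ b)) = true} := by
    ext χ
    simp only [Set.mem_inter_iff, Set.mem_iInter, Set.mem_ofPred_eq]
    exact ⟨fun h => ⟨⟨h.zero, h.inter⟩, h.sdiff⟩, fun h => ⟨h.1.1, h.1.2, h.2⟩⟩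
  rw [this]
  refine ((isOpen_setOf_apply 0).isClosed_compl.inter
    (isClosed_iInter fun a => isClosed_iInter fun b => ?_)).inter
    (isClosed_iInter fun a => isClosed_iInter fun b => ?_)
  · exact isClosed_setOf_apply₃ (a ∩ b) a b fun x y z => x = true ↔ y = true ∧ z = true
  · exact isClosed_setOf_apply₃ a b (a \ (a ∩ b)) fun x y z => x = true → ¬ y = true → z = true

theorem IsBasePoint.zero (h : IsBasePoint χ) : ¬ χ 0 = true := by
  intro h0
  rw [← sdiff_meet_eq_zero 0 0, h.meet, h.sdiff] at h0
  exact h0.1.2 h0.2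

theorem IsBasePoint.mono (h : IsBasePoint χ) (hab : NatLE a b) (ha : χ a = true) :
    χ b = true := by
  rw [← hab.1, h.meet] at ha
  exact ha.2

theorem IsTotalPoint.mono (h : IsTotalPoint χ) (hab : NatLE a b) (ha : χ a = true) :
    χ b = true := by
  rw [← inter_eq_left hab, h.inter] at ha
  exact ha.2

/-- A nonzero element is contained in a base point. -/
theorem exists_isBasePoint (hc : c ≠ 0) : ∃ χ : A.carrier → Bool, IsBasePoint χ ∧ χ c = true := by
  classical
  obtain ⟨F, hcF, hmeet, hF⟩ := exists_maximal_meetClosed hc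
  have hn : ∀ x, x ∉ F → ∃ f ∈ F, x ⊓ f = 0 := fun x hx => by
    by_contra! h
    exact hx ((hF x).2 h)
  have hl : ∀ x y : A.carrier, y ⊓ x = x → x ∈ F → y ∈ F := fun x y hxy hx => by
    rw [hF] at hx ⊢
    intro f hf h
    exact hx f hf (by rw [← hxy, meet_assoc, meet_left_comm, h, meet_zero])
  have hm : ∀ x y, x ⊓ y ∈ F ↔ x ∈ F ∧ y ∈ F := fun x y =>
    ⟨fun h => ⟨hl _ x (meet_idem_left x y) h, hl _ y (meet_natLE_right x y).2 h⟩,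
      fun h => hmeet x h.1 y h.2⟩
  have hj : ∀ x y, x ⊔ y ∈ F ↔ x ∈ F ∨ y ∈ F := fun x y => by
    constructor
    · intro h
      by_contra! hxy
      obtain ⟨f, hf, hxf⟩ := hn x hxy.1
      obtain ⟨g, hg, hyg⟩ := hn y hxy.2
      refine (hF _).1 h (f ⊓ g) (hmeet f hf g hg) ?_
      rw [join_meet_distrib, ← meet_assoc, hxf, zero_meet, zero_join, meet_left_comm, hyg,
        meet_zero]
    · rintro (h | h)
      · exact ((hm _ _).1 (by rwa [meet_join_absorb] : x ⊓ (x ⊔ y) ∈ F)).2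
      · exact ((hm _ _).1 (by rwa [join_meet_absorb] : (x ⊔ y) ⊓ y ∈ F)).1
  have h0 : (0 : A.carrier) ∉ F := fun h => (hF 0).1 h c hcF (zero_meet c)
  refine ⟨fun x => decide (x ∈ F), ⟨?_, ?_, ?_⟩, by simpa using hcF⟩ <;> intro x y <;>
    simp only [decide_eq_true_eq]
  · exact hm x y
  · exact hj x y
  · constructor
    · intro h
      refine ⟨hl _ x (sdiff_natLE x y).2 h, fun hy => h0 ?_⟩
      rw [← sdiff_meet_eq_zero x y]
      exact hmeet _ h _ hy
    · rintro ⟨hx, hy⟩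
      rw [← sdiff_join_meet x y, hj, hm] at hx
      tauto

/-- The point of the total space over a base point `χ` which contains a given element of `χ`. -/
def sectionAt (a : A.carrier) (χ : A.carrier → Bool) : A.carrier → Bool := fun b => χ (a ∩ b)

theorem sectionAt_self (a : A.carrier) (χ : A.carrier → Bool) : sectionAt a χ a = χ a := by
  rw [sectionAt, inter_eq_left (natLE_refl a)]

theorem IsBasePoint.sectionAt (h : IsBasePoint χ) (a : A.carrier) :
    IsTotalPoint (sectionAt a χ) where
  zero := by
    rw [SkewDuality.sectionAt, inter_eq_right (zero_natLE a)]
    exact h.zero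
  inter b c := by
    simp only [SkewDuality.sectionAt]
    rw [inter_inter_distrib, h.meet]
  sdiff b c hb hc := by
    simp only [SkewDuality.sectionAt] at *
    exact h.mono (le_inter _ _ _ ((sdiff_natLE _ _).trans (inter_le_left _ _))
      (inter_sdiff_natLE a b c)) ((h.sdiff _ _).2 ⟨hb, hc⟩)

/-- The point of the base under a point of the total space. -/
noncomputable def underlying (χ : A.carrier → Bool) : A.carrier → Bool := by
  classical exact fun b => decide (∃ a, χ a = true ∧ χ (b ⊓ a) = true)

theorem IsTotalPoint.underlying_iff (h : IsTotalPoint χ) (ha : χ a = true) (b : A.carrier) :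
    underlying χ b = true ↔ χ (b ⊓ a) = true := by
  simp only [underlying, decide_eq_true_eq]
  refine ⟨?_, fun h => ⟨a, ha, h⟩⟩
  rintro ⟨c, hc, hb⟩
  refine h.mono (natLE_meet (inter_le_right (b ⊓ c) a) ?_) ((h.inter _ _).2 ⟨hb, ha⟩)
  rw [← (inter_le_left (b ⊓ c) a).2, meet_assoc, meet_idem_left]

theorem IsTotalPoint.underlying_of_mem (h : IsTotalPoint χ) (ha : χ a = true) :
    underlying χ a = true := by
  rw [h.underlying_iff ha, meet_idem, ha]

theorem IsTotalPoint.join (h : IsTotalPoint χ) (ha : NatLE a (a ⊔ b)) (hb : NatLE b (a ⊔ b)) :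
    χ (a ⊔ b) = true ↔ χ a = true ∨ χ b = true := by
  constructor
  · intro hab
    by_contra! hn
    have h1 := h.sdiff _ a hab hn.1
    have h2 := h.sdiff _ b hab hn.2
    rw [inter_eq_right ha] at h1
    rw [inter_eq_right hb] at h2
    have h3 := (h.inter _ _).2 ⟨h1, h2⟩
    have key : ((a ⊔ b) \ a) ∩ ((a ⊔ b) \ b) = 0 := by
      have hd1 := inter_le_left ((a ⊔ b) \ a) ((a ⊔ b) \ b)
      have hd2 := inter_le_right ((a ⊔ b) \ a) ((a ⊔ b) \ b)
      have hd := (hd1.trans (sdiff_natLE _ _)).1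
      rw [meet_join_distrib] at hd
      conv_lhs at hd => lhs; rw [← hd1.1, meet_assoc, sdiff_meet_eq_zero, meet_zero]
      conv_lhs at hd => rhs; rw [← hd2.1, meet_assoc, sdiff_meet_eq_zero, meet_zero]
      rw [zero_join] at hd
      exact hd.symm
    rw [key] at h3
    exact h.zero h3
  · rintro (h' | h')
    · exact h.mono ha h'
    · exact h.mono hb h'

theorem IsTotalPoint.isBasePoint_underlying (h : IsTotalPoint χ) (ha : χ a = true) :
    IsBasePoint (underlying χ) := by
  have hj : ∀ b c, underlying χ (b ⊔ c) = true ↔ underlying χ b = true ∨ underlying χ c = true := by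
    intro b c
    simp only [h.underlying_iff ha]
    rw [join_meet_distrib, h.join]
    · rw [natLE_iff_meet_eq, meet_join_absorb]
    · rw [natLE_iff_meet_eq, meet_join_distrib,
        meet_comm_of_natLE (meet_natLE_right c a) (meet_natLE_right b a), meet_idem,
        meet_join_absorb']
  have hm : ∀ b c, underlying χ (b ⊓ c) = true ↔ underlying χ b = true ∧ underlying χ c = true := by
    intro b c
    simp only [h.underlying_iff ha, meet_assoc]
    constructor
    · intro hbc
      refine ⟨h.mono ?_ hbc, h.mono (meet_natLE_right _ _) hbc⟩
      rw [meet_left_comm]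
      exact meet_natLE_right _ _
    · rintro ⟨hb, hc⟩
      refine h.mono (natLE_meet (inter_le_right (b ⊓ a) (c ⊓ a)) ?_) ((h.inter _ _).2 ⟨hb, hc⟩)
      rw [← (inter_le_left (b ⊓ a) (c ⊓ a)).2, meet_assoc, meet_idem_left]
  have h0 : ¬ underlying χ 0 = true := by
    rw [h.underlying_iff ha, zero_meet]
    exact h.zero
  refine ⟨hm, hj, fun b c => ⟨fun hbc => ⟨?_, fun hc => h0 ?_⟩, ?_⟩⟩
  · rw [← (sdiff_natLE b c).1, hm] at hbc
    exact hbc.2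
  · rw [← sdiff_meet_eq_zero b c, hm]
    exact ⟨hbc, hc⟩
  · rintro ⟨hb, hc⟩
    rw [← sdiff_join_meet b c, hj, hm] at hb
    tauto

theorem IsTotalPoint.sectionAt_underlying (h : IsTotalPoint χ) (ha : χ a = true) :
    sectionAt a (underlying χ) = χ := by
  funext b
  rw [Bool.eq_iff_iff, sectionAt, h.underlying_iff ha, (inter_le_left a b).1, h.inter]
  exact and_iff_right ha

theorem IsBasePoint.underlying_sectionAt (h : IsBasePoint χ) (ha : χ a = true) :
    underlying (SkewDuality.sectionAt a χ) = χ := by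
  funext b
  rw [Bool.eq_iff_iff, (h.sectionAt a).underlying_iff (by rwa [sectionAt_self]),
    SkewDuality.sectionAt, inter_eq_right (meet_natLE_right b a), h.meet]
  exact and_iff_left ha

variable (A) in
/-- The base of the spectrum. -/
abbrev BaseSpectrum : Type u := NonzeroPoints {χ : A.carrier → Bool | IsBasePoint χ}

variable (A) in
/-- The total space of the spectrum. -/
abbrev TotalSpectrum : Type u := NonzeroPoints {χ : A.carrier → Bool | IsTotalPoint χ}

/-- The projection of the spectrum. -/
noncomputable def spectrumProj (χ : TotalSpectrum A) : BaseSpectrum A :=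
  ⟨underlying χ.1, χ.2.1.isBasePoint_underlying χ.2.2.choose_spec, _,
    χ.2.1.underlying_of_mem χ.2.2.choose_spec⟩

/-- The points of the total space containing a given element. -/
def basicOpen (a : A.carrier) : Set (TotalSpectrum A) := {χ | χ.1 a = true}

theorem isOpen_basicOpen (a : A.carrier) : IsOpen (basicOpen a) :=
  (isOpen_setOf_apply a).preimage continuous_subtype_val

theorem isCompact_basicOpen (a : A.carrier) : IsCompact (basicOpen a) :=
  isCompact_nonzeroPoints isClosed_isTotalPoint a

/-- The points of the total space over a fixed base point containing `a` are unique. -/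
theorem injOn_spectrumProj (a : A.carrier) : Set.InjOn spectrumProj (basicOpen a) := by
  intro χ hχ ψ hψ h
  apply Subtype.ext
  rw [← χ.2.1.sectionAt_underlying hχ, ← ψ.2.1.sectionAt_underlying hψ]
  exact congrArg (sectionAt a) (congrArg Subtype.val h)

theorem exists_spectrumProj_eq (χ : BaseSpectrum A) (ha : χ.1 a = true) :
    ∃ ψ ∈ basicOpen a, spectrumProj ψ = χ :=
  ⟨⟨sectionAt a χ.1, χ.2.1.sectionAt a, a, by rwa [sectionAt_self]⟩,
    (sectionAt_self a χ.1).trans ha, Subtype.ext (χ.2.1.underlying_sectionAt ha)⟩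

theorem spectrumProj_image_basicOpen (a : A.carrier) :
    spectrumProj '' basicOpen a = {χ | χ.1 a = true} := by
  ext χ
  constructor
  · rintro ⟨ψ, hψ, rfl⟩
    exact ψ.2.1.underlying_of_mem hψ
  · exact fun h => exists_spectrumProj_eq χ h

theorem isTopologicalBasis_basicOpen :
    TopologicalSpace.IsTopologicalBasis (Set.range (basicOpen (A := A))) := by
  refine TopologicalSpace.isTopologicalBasis_of_isOpen_of_nhds ?_ ?_
  · rintro _ ⟨a, rfl⟩
    exact isOpen_basicOpen a
  · intro χ U hχ hU
    obtain ⟨V, hV, rfl⟩ := isOpen_induced_iff.1 hU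
    obtain ⟨I, u, hu, hI⟩ := isOpen_pi_iff.1 hV χ.1 hχ
    suffices ∀ J : Finset A.carrier, ∃ a, χ.1 a = true ∧
        ∀ ψ : TotalSpectrum A, ψ.1 a = true → ∀ b ∈ J, ψ.1 b = χ.1 b by
      obtain ⟨a, ha, h⟩ := this I
      exact ⟨_, ⟨a, rfl⟩, ha, fun ψ hψ => hI fun b hb => by
        rw [h ψ hψ b hb]
        exact (hu b hb).2⟩
    classical
    intro J
    induction J using Finset.induction_on with
    | empty => exact ⟨_, χ.2.2.choose_spec, by simp⟩
    | insert c J _ ih =>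
      obtain ⟨a, ha, h⟩ := ih
      by_cases hc : χ.1 c = true
      · refine ⟨a ∩ c, (χ.2.1.inter _ _).2 ⟨ha, hc⟩, fun ψ hψ b hb => ?_⟩
        have hψ' := (ψ.2.1.inter _ _).1 hψ
        obtain rfl | hb := Finset.mem_insert.1 hb
        · rw [hψ'.2, hc]
        · exact h ψ hψ'.1 b hb
      · refine ⟨a \ (a ∩ c), χ.2.1.sdiff _ _ ha hc, fun ψ hψ b hb => ?_⟩
        have hψ' := ψ.2.1.mono (sdiff_natLE _ _) hψ
        obtain rfl | hb := Finset.mem_insert.1 hb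
        · rw [Bool.eq_false_of_not_eq_true hc]
          refine Bool.eq_false_of_not_eq_true fun hb => ψ.2.1.zero ?_
          have h1 := (ψ.2.1.inter _ _).2 ⟨hψ, (ψ.2.1.inter _ _).2 ⟨hψ', hb⟩⟩
          rwa [inter_eq_meet (sdiff_natLE _ _) (inter_le_left _ _), sdiff_meet_eq_zero] at h1
        · exact h ψ hψ' b hb

theorem continuous_spectrumProj : Continuous (spectrumProj (A := A)) := by
  refine Continuous.subtype_mk (continuous_pi fun b => ?_) _
  rw [continuous_iff_continuousAt]
  intro χ
  obtain ⟨a, ha⟩ := χ.2.2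
  have h : ContinuousAt (fun ψ : TotalSpectrum A => ψ.1 (b ⊓ a)) χ :=
    ((continuous_apply (b ⊓ a)).comp continuous_subtype_val).continuousAt
  refine h.congr ?_
  filter_upwards [(isOpen_basicOpen a).mem_nhds ha] with ψ hψ
  rw [Bool.eq_iff_iff, ψ.2.1.underlying_iff hψ]

theorem isOpenMap_spectrumProj : IsOpenMap (spectrumProj (A := A)) := by
  rw [isTopologicalBasis_basicOpen.isOpenMap_iff]
  rintro _ ⟨a, rfl⟩
  rw [spectrumProj_image_basicOpen]
  exact (isOpen_setOf_apply a).preimage continuous_subtype_val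

theorem isLocalHomeomorph_spectrumProj : IsLocalHomeomorph (spectrumProj (A := A)) := by
  rw [isLocalHomeomorph_iff_isOpenEmbedding_restrict]
  intro χ
  obtain ⟨a, ha⟩ := χ.2.2
  exact ⟨basicOpen a, (isOpen_basicOpen a).mem_nhds ha,
    .of_continuous_injective_isOpenMap (continuous_spectrumProj.comp continuous_subtype_val)
      (Set.injOn_iff_injective.1 (injOn_spectrumProj a))
      (isOpenMap_spectrumProj.comp (isOpen_basicOpen a).isOpenMap_subtype_val)⟩

variable (A) in
/-- The spectrum of a right-handed skew algebra. -/
noncomputable def spectrum : SkewBooleanSpace.{u} :=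
  haveI := booleanSpace_nonzeroPoints (isClosed_isTotalPoint (A := A))
  haveI := booleanSpace_nonzeroPoints (isClosed_isBasePoint (A := A))
  { total := TotalSpectrum A
    base := BaseSpectrum A
    proj := spectrumProj
    etale := isLocalHomeomorph_spectrumProj
    surj := fun χ => by
      obtain ⟨a, ha⟩ := χ.2.2
      obtain ⟨ψ, -, h⟩ := exists_spectrumProj_eq χ ha
      exact ⟨ψ, h⟩ }

/-- The copen section of the spectrum given by an element of the algebra. -/
def basicSection (a : A.carrier) : CopenSection (spectrum A) where
  carrier := basicOpen a
  isOpen := isOpen_basicOpen a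
  isCompact := isCompact_basicOpen a
  injOn := injOn_spectrumProj a

theorem mem_saturation_basicSection {χ : TotalSpectrum A} :
    χ ∈ saturation (spectrum A) (basicSection a).carrier ↔ underlying χ.1 a = true := by
  change spectrumProj χ ∈ spectrumProj '' basicOpen a ↔ _
  rw [spectrumProj_image_basicOpen]
  rfl

theorem basicSection_meet (a b : A.carrier) :
    basicSection (a ⊓ b) = basicSection a ⊓ basicSection b := by
  refine CopenSection.ext (Set.ext fun χ : TotalSpectrum A => ?_)
  suffices χ.1 (a ⊓ b) = true ↔ underlying χ.1 a = true ∧ χ.1 b = true from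
    this.trans (and_congr_left' mem_saturation_basicSection.symm)
  constructor
  · intro h
    have hb := χ.2.1.mono (meet_natLE_right a b) h
    exact ⟨(χ.2.1.underlying_iff hb a).2 h, hb⟩
  · rintro ⟨h, hb⟩
    exact (χ.2.1.underlying_iff hb a).1 h

theorem basicSection_join (a b : A.carrier) :
    basicSection (a ⊔ b) = basicSection a ⊔ basicSection b := by
  refine CopenSection.ext (Set.ext fun χ : TotalSpectrum A => ?_)
  suffices χ.1 (a ⊔ b) = true ↔ χ.1 a = true ∨ χ.1 b = true ∧ ¬ underlying χ.1 a = true from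
    this.trans (or_congr_right (and_congr_right' mem_saturation_basicSection.not.symm))
  have hχ := χ.2.1.isBasePoint_underlying χ.2.2.choose_spec
  by_cases ha : underlying χ.1 a = true
  · simp only [ha, not_true_eq_false, and_false, or_false]
    refine ⟨fun h => ?_, χ.2.1.mono (natLE_iff_meet_eq.2 (meet_join_absorb a b))⟩
    rwa [χ.2.1.underlying_iff h, meet_join_absorb] at ha
  · rw [and_iff_left ha, or_iff_right fun h => ha (χ.2.1.underlying_of_mem h)]
    constructor
    · intro h
      have hb := ((hχ.join _ _).1 (χ.2.1.underlying_of_mem h)).resolve_left ha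
      have := (χ.2.1.underlying_iff h _).1 ((hχ.sdiff b a).2 ⟨hb, ha⟩)
      rw [sdiff_meet_join] at this
      exact χ.2.1.mono (sdiff_natLE b a) this
    · intro hb
      have := (χ.2.1.underlying_iff hb _).1
        ((hχ.sdiff b a).2 ⟨χ.2.1.underlying_of_mem hb, ha⟩)
      rw [(sdiff_natLE b a).1] at this
      exact χ.2.1.mono (natLE_iff_meet_eq.2 (sdiff_meet_join a b)) this

theorem basicSection_sdiff (a b : A.carrier) :
    basicSection (a \ b) = basicSection a \ basicSection b := by
  refine CopenSection.ext (Set.ext fun χ : TotalSpectrum A => ?_)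
  suffices χ.1 (a \ b) = true ↔ χ.1 a = true ∧ ¬ underlying χ.1 b = true from
    this.trans (and_congr_right' mem_saturation_basicSection.not.symm)
  have hχ := χ.2.1.isBasePoint_underlying χ.2.2.choose_spec
  constructor
  · intro h
    exact ⟨χ.2.1.mono (sdiff_natLE a b) h,
      ((hχ.sdiff a b).1 (χ.2.1.underlying_of_mem h)).2⟩
  · rintro ⟨ha, hb⟩
    have := (χ.2.1.underlying_iff ha _).1
      ((hχ.sdiff a b).2 ⟨χ.2.1.underlying_of_mem ha, hb⟩)
    rwa [(sdiff_natLE a b).1] at this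

variable (A) in
/-- The representation of a right-handed skew algebra by copen sections of its spectrum. -/
def representation : SkewHom A.carrier (CopenSection (spectrum A)) where
  toFun := basicSection
  map_zero := CopenSection.ext (Set.eq_empty_of_forall_notMem fun χ hχ => χ.2.1.zero hχ)
  map_meet := basicSection_meet
  map_join := basicSection_join
  map_sdiff := basicSection_sdiff
  map_inter a b := CopenSection.ext (Set.ext fun χ => χ.2.1.inter a b)

theorem natLE_of_basicOpen_subset (h : basicOpen a ⊆ basicOpen b) : NatLE a b := by
  by_contra hab
  have hc : a \ (a ∩ b) ≠ 0 := by
    intro h0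
    have := sdiff_join_of_natLE (inter_le_left a b)
    rw [h0, zero_join] at this
    exact hab (this ▸ inter_le_right a b)
  obtain ⟨χ, hχ, hχc⟩ := exists_isBasePoint hc
  obtain ⟨ψ, hψ, -⟩ := exists_spectrumProj_eq ⟨χ, hχ, _, hχc⟩ hχc
  have ha : ψ.1 a = true := ψ.2.1.mono (sdiff_natLE _ _) hψ
  have h1 := (ψ.2.1.inter _ _).2 ⟨hψ, (ψ.2.1.inter _ _).2 ⟨ha, h ha⟩⟩
  rw [inter_eq_meet (sdiff_natLE _ _) (inter_le_left _ _), sdiff_meet_eq_zero] at h1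
  exact ψ.2.1.zero h1

theorem basicSection_injective : Function.Injective (basicSection (A := A)) := by
  intro a b h
  have h' : basicOpen a = basicOpen b := congrArg CopenSection.carrier h
  exact (natLE_of_basicOpen_subset h'.subset).antisymm (natLE_of_basicOpen_subset h'.superset)

theorem basicSection_surjective : Function.Surjective (basicSection (A := A)) := by
  intro S
  suffices ∃ a : A.carrier, S.carrier ⊆ basicOpen a ∧ basicOpen a ⊆ S.carrier by
    obtain ⟨a, h, h'⟩ := this
    exact ⟨a, CopenSection.ext (h'.antisymm h)⟩
  refine S.isCompact.induction_on
    (p := fun K => ∃ a : A.carrier, K ⊆ basicOpen a ∧ basicOpen a ⊆ S.carrier) ?_ ?_ ?_ ?_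
  · exact ⟨0, Set.empty_subset _, fun χ hχ => absurd hχ χ.2.1.zero⟩
  · rintro K L hKL ⟨a, h, h'⟩
    exact ⟨a, hKL.trans h, h'⟩
  · rintro K L ⟨a, ha, ha'⟩ ⟨b, hb, hb'⟩
    have h : basicOpen (a ⊔ b) = basicOpen a ∪
        (basicOpen b \ saturation (spectrum A) (basicOpen a)) :=
      congrArg CopenSection.carrier (basicSection_join a b)
    refine ⟨a ⊔ b, ?_, ?_⟩
    · rintro χ (hχ | hχ)
      · rw [h]
        exact Or.inl (ha hχ)
      · rw [h]
        by_cases hs : χ ∈ saturation (spectrum A) (basicOpen a)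
        · obtain ⟨ψ, hψ, hψχ⟩ := hs
          have := S.injOn (ha' hψ) (hb' (hb hχ)) hψχ
          exact Or.inl (this ▸ hψ)
        · exact Or.inr ⟨hb hχ, hs⟩
    · rw [h]
      exact Set.union_subset ha' (Set.sdiff_subset.trans hb')
  · intro χ hχ
    obtain ⟨_, ⟨a, rfl⟩, ha, haS⟩ :=
      isTopologicalBasis_basicOpen.exists_subset_of_mem_open hχ S.isOpen
    exact ⟨basicOpen a, mem_nhdsWithin_of_mem_nhds ((isOpen_basicOpen a).mem_nhds ha), a,
      subset_rfl, haS⟩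

end Spectrum

/-- A bijective homomorphism is an isomorphism. -/
theorem isIso_of_bijective {A B : RightHandedSkewAlgebra.{u}} (f : A ⟶ B)
    (hf : Function.Bijective (SkewHom.toFun f)) : IsIso f := by
  obtain ⟨g, hgf, hfg⟩ := Function.bijective_iff_has_inverse.1 hf
  refine ⟨⟨g, ?_, ?_, ?_, ?_, ?_⟩, SkewHom.ext (funext hgf), SkewHom.ext (funext hfg)⟩
  · rw [← SkewHom.map_zero f, hgf]
  · intro x y
    apply hf.1
    rw [SkewHom.map_meet, hfg, hfg, hfg]
  · intro x y
    apply hf.1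
    rw [SkewHom.map_join, hfg, hfg, hfg]
  · intro x y
    apply hf.1
    rw [SkewHom.map_sdiff, hfg, hfg, hfg]
  · intro x y
    apply hf.1
    rw [SkewHom.map_inter, hfg, hfg, hfg]

instance essSurj_copenSections : copenSections.{u}.EssSurj where
  mem_essImage A := by
    let f : A ⟶ copenSections.obj (Opposite.op (spectrum A)) := representation A
    have : IsIso f := isIso_of_bijective f ⟨basicSection_injective, basicSection_surjective⟩
    exact ⟨Opposite.op (spectrum A), ⟨(asIso f).symm⟩⟩

/-! ## Copen sections -/

section Sections

variable {p p' : SkewBooleanSpace.{u}}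

theorem exists_copenSection_mem {U : Set p.total} (hU : IsOpen U) {y : p.total} (hy : y ∈ U) :
    ∃ S : CopenSection p, y ∈ S.carrier ∧ S.carrier ⊆ U := by
  obtain ⟨e, he, hpe⟩ := p.etale y
  obtain ⟨K, hK, hyK, hKU⟩ := exists_compact_subset (hU.inter e.open_source) ⟨hy, he⟩
  obtain ⟨C, hC, hyC, hCK⟩ :=
    BooleanSpace.isTopologicalBasis_isClopen.exists_subset_of_mem_open hyK isOpen_interior
  have hCK' := hCK.trans interior_subset
  refine ⟨⟨C, hC.isOpen, hK.of_isClosed_subset hC.isClosed hCK', ?_⟩, hyC,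
    hCK'.trans (hKU.trans Set.inter_subset_left)⟩
  rw [hpe]
  exact e.injOn.mono (hCK'.trans (hKU.trans Set.inter_subset_right))

theorem exists_copenSection (y : p.total) : ∃ S : CopenSection p, y ∈ S.carrier := by
  obtain ⟨S, hS, -⟩ := exists_copenSection_mem isOpen_univ (Set.mem_univ y)
  exact ⟨S, hS⟩

variable (p) in
theorem isTopologicalBasis_copenSection :
    TopologicalSpace.IsTopologicalBasis (Set.range (CopenSection.carrier (p := p))) := by
  refine TopologicalSpace.isTopologicalBasis_of_isOpen_of_nhds ?_ ?_
  · rintro _ ⟨S, rfl⟩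
    exact S.isOpen
  · intro y U hy hU
    obtain ⟨S, hS, hSU⟩ := exists_copenSection_mem hU hy
    exact ⟨_, ⟨S, rfl⟩, hS, hSU⟩

theorem isOpen_image (S : CopenSection p) : IsOpen (p.proj '' S.carrier) :=
  p.etale.isOpenMap _ S.isOpen

theorem isCompact_image (S : CopenSection p) : IsCompact (p.proj '' S.carrier) :=
  S.isCompact.image p.etale.continuous

variable (p) in
theorem isTopologicalBasis_image_copenSection : TopologicalSpace.IsTopologicalBasis
    (Set.range fun S : CopenSection p => p.proj '' S.carrier) := by
  refine TopologicalSpace.isTopologicalBasis_of_isOpen_of_nhds ?_ ?_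
  · rintro _ ⟨S, rfl⟩
    exact isOpen_image S
  · intro x U hx hU
    obtain ⟨y, rfl⟩ := p.surj x
    obtain ⟨S, hS, hSU⟩ := exists_copenSection_mem (hU.preimage p.etale.continuous) hx
    exact ⟨_, ⟨S, rfl⟩, ⟨y, hS, rfl⟩, Set.image_subset_iff.2 hSU⟩

/-- Points of the total space are separated by copen sections. -/
theorem eq_of_mem_copenSection_iff {y z : p.total}
    (h : ∀ S : CopenSection p, y ∈ S.carrier → z ∈ S.carrier) : y = z := by
  by_contra hyz
  obtain ⟨S, hS, hSz⟩ := exists_copenSection_mem (isOpen_compl_singleton (x := z)) hyz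
  exact hSz (h S hS) rfl

/-- Inside a section, the join is the union. -/
theorem carrier_join_of_injOn {S R : CopenSection p} {T : Set p.total}
    (hT : Set.InjOn p.proj T) (hS : S.carrier ⊆ T) (hR : R.carrier ⊆ T) :
    (S ⊔ R).carrier = S.carrier ∪ R.carrier := by
  refine (Set.union_subset_union_right _ Set.sdiff_subset).antisymm ?_
  rintro y (hy | hy)
  · exact Or.inl hy
  · by_cases hs : y ∈ saturation p S.carrier
    · obtain ⟨z, hz, hzy⟩ := hs
      exact Or.inl (hT (hS hz) (hR hy) hzy ▸ hz)
    · exact Or.inr ⟨hy, hs⟩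

theorem image_join (S R : CopenSection p) :
    p.proj '' (S ⊔ R).carrier = p.proj '' S.carrier ∪ p.proj '' R.carrier := by
  apply p.surj.preimage_injective
  exact saturation_union S.carrier R.carrier

/-- There is a copen section above every copen subset of the base. -/
theorem exists_copenSection_above {U : Set p.base} (hU : IsOpen U) (hU' : IsCompact U) :
    ∃ S : CopenSection p, p.proj '' S.carrier = U := by
  suffices ∃ S : CopenSection p, U ⊆ p.proj '' S.carrier ∧ p.proj '' S.carrier ⊆ U by
    obtain ⟨S, h, h'⟩ := this
    exact ⟨S, h'.antisymm h⟩
  refine hU'.induction_on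
    (p := fun K => ∃ S : CopenSection p, K ⊆ p.proj '' S.carrier ∧ p.proj '' S.carrier ⊆ U)
    ⟨0, Set.empty_subset _, by simp [carrier_zero]⟩ ?_ ?_ ?_
  · rintro K L hKL ⟨S, h, h'⟩
    exact ⟨S, hKL.trans h, h'⟩
  · rintro K L ⟨S, hS, hS'⟩ ⟨R, hR, hR'⟩
    refine ⟨S ⊔ R, ?_, ?_⟩ <;> rw [image_join]
    · exact Set.union_subset_union hS hR
    · exact Set.union_subset hS' hR'
  · intro x hx
    obtain ⟨_, ⟨S, rfl⟩, hxS, hSU⟩ :=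
      (isTopologicalBasis_image_copenSection p).exists_subset_of_mem_open hx hU
    exact ⟨_, mem_nhdsWithin_of_mem_nhds ((isOpen_image S).mem_nhds hxS), S, subset_rfl, hSU⟩

theorem meet_eq_right_iff (S R : CopenSection p) :
    S ⊓ R = R ↔ p.proj '' R.carrier ⊆ p.proj '' S.carrier := by
  rw [CopenSection.ext_iff, carrier_meet, Set.inter_eq_right, Set.image_subset_iff]
  rfl

theorem greenD_copenSection_iff (S R : CopenSection p) :
    GreenD S R ↔ p.proj '' S.carrier = p.proj '' R.carrier :=
  ((greenD_iff (copenSections.obj (Opposite.op p)) S R).trans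
    (and_congr (meet_eq_right_iff R S) (meet_eq_right_iff S R))).trans
    Set.Subset.antisymm_iff.symm

theorem image_pullback (m : p ⟶ p') (R : CopenSection p') :
    p.proj '' (R.pullback m).carrier = m.h.preimage (p'.proj '' R.carrier) := by
  ext x
  constructor
  · rintro ⟨y, ⟨z, hz, hyz⟩, rfl⟩
    exact ⟨p'.proj z, ⟨z, hz, rfl⟩, m.comm y z hyz⟩
  · rintro ⟨_, ⟨z, hz, rfl⟩, hx⟩
    obtain ⟨y, ⟨hyx, hyz⟩, -⟩ := m.bij_fibres x _ hx z rfl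
    exact ⟨y, ⟨z, hz, hyz⟩, hyx⟩

theorem dSaturated_iff_lifting (m : p ⟶ p') :
    dSaturated (copenSections.map m.op) ↔ lifting m := by
  constructor
  · intro hm U hU hU' S hS
    obtain ⟨R, rfl⟩ := exists_copenSection_above hU hU'
    rw [← image_pullback] at hS
    obtain ⟨T, hT⟩ := hm _ ⟨R, rfl⟩ S ((greenD_copenSection_iff _ _).2 hS.symm)
    replace hT : T.pullback m = S := hT
    refine ⟨(R ⊓ T) ⊔ R, ?_, ?_⟩
    · rw [image_join, Set.union_eq_right, ← meet_eq_right_iff]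
      exact SkewLattice.meet_assoc R R T ▸ congrArg (· ⊓ T) (SkewLattice.meet_idem R)
    · have h := ((pullbackHom m).map_join (R ⊓ T) R).trans
        (congrArg (· ⊔ R.pullback m) ((pullbackHom m).map_meet R T))
      change ((R ⊓ T) ⊔ R).pullback m = (R.pullback m ⊓ T.pullback m) ⊔ R.pullback m at h
      rw [hT, (meet_eq_right_iff _ _).2 hS.subset] at h
      have h' := SkewLattice.join_meet_absorb' S (R.pullback m)
      rw [(meet_eq_right_iff _ _).2 hS.superset] at h'
      exact (congrArg CopenSection.carrier (h.trans h')).symm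
  · rintro hm _ ⟨R, rfl⟩ S hS
    have hS' := (greenD_copenSection_iff _ _).1 hS
    obtain ⟨T, -, hT⟩ := hm (p'.proj '' R.carrier) (isOpen_image R) (isCompact_image R) S
      (hS'.symm.trans (image_pullback m R))
    exact ⟨T, CopenSection.ext hT.symm⟩

end Sections

/-! ## Morphisms of skew Boolean spaces from homomorphisms -/

/-- The partial map with a given graph. -/
noncomputable def partialMapOfGraph {X Y : Type u} (r : X → Y → Prop) : X →. Y :=
  fun x => ⟨∃ y, r x y, fun h => h.choose⟩

theorem mem_partialMapOfGraph {X Y : Type u} {r : X → Y → Prop}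
    (hr : ∀ x y z, r x y → r x z → y = z) {x : X} {y : Y} :
    y ∈ partialMapOfGraph r x ↔ r x y := by
  constructor
  · rintro ⟨h, rfl⟩
    exact h.choose_spec
  · exact fun h => ⟨⟨y, h⟩, hr _ _ _ (Exists.choose_spec ⟨y, h⟩) h⟩

/-- It suffices to check that preimages of basic open sets are compact and open. -/
theorem isProperPartial_of_basis {X Y : Type u} [TopologicalSpace X] [TopologicalSpace Y]
    [T2Space Y] {f : X →. Y} {B : Set (Set Y)} (hB : TopologicalSpace.IsTopologicalBasis B)
    (ho : ∀ s ∈ B, IsOpen (f.preimage s)) (hc : ∀ s ∈ B, IsCompact (f.preimage s)) :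
    IsProperPartial f := by
  have ho' : ∀ s, IsOpen s → IsOpen (f.preimage s) := fun s hs => by
    rw [isOpen_iff_forall_mem_open]
    rintro x ⟨y, hy, hxy⟩
    obtain ⟨t, ht, hyt, hts⟩ := hB.exists_subset_of_mem_open hy hs
    exact ⟨f.preimage t, f.preimage_mono hts, ho t ht, y, hyt, hxy⟩
  refine .of_isOpen_preimage ho' fun K hK => ?_
  obtain ⟨V, hKV, hV⟩ : ∃ V, K ⊆ V ∧ IsCompact (f.preimage V) := by
    refine hK.induction_on (p := fun K => ∃ V, K ⊆ V ∧ IsCompact (f.preimage V)) ?_ ?_ ?_ ?_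
    · exact ⟨∅, subset_rfl, by
        convert isCompact_empty using 1
        exact Set.eq_empty_of_forall_notMem fun x ⟨y, hy, _⟩ => hy⟩
    · rintro K L hKL ⟨V, h, h'⟩
      exact ⟨V, hKL.trans h, h'⟩
    · rintro K L ⟨V, hV, hV'⟩ ⟨W, hW, hW'⟩
      exact ⟨V ∪ W, Set.union_subset_union hV hW, by
        rw [PFun.preimage_union]
        exact hV'.union hW'⟩
    · intro y _
      obtain ⟨t, ht, hyt, -⟩ := hB.exists_subset_of_mem_open (Set.mem_univ y) isOpen_univ
      exact ⟨t, mem_nhdsWithin_of_mem_nhds ((hB.isOpen ht).mem_nhds hyt), t, subset_rfl, hc t ht⟩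
  convert hV.diff (ho' _ hK.isClosed.isOpen_compl) using 1
  ext x
  constructor
  · rintro ⟨y, hy, hxy⟩
    exact ⟨⟨y, hKV hy, hxy⟩, fun ⟨z, hz, hxz⟩ => hz (Part.mem_unique hxy hxz ▸ hy)⟩
  · rintro ⟨⟨y, -, hxy⟩, h⟩
    by_contra hx
    exact h ⟨y, fun hy => hx ⟨y, hy, hxy⟩, hxy⟩

section Dual

variable {p p' : SkewBooleanSpace.{u}} {φ : SkewHom (CopenSection p') (CopenSection p)}

/-- The graph of the partial map dual to a homomorphism. -/
def DualGraph (φ : SkewHom (CopenSection p') (CopenSection p)) (y : p.total) (z : p'.total) :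
    Prop :=
  ∀ R : CopenSection p', z ∈ R.carrier ↔ y ∈ (φ.toFun R).carrier

theorem DualGraph.unique (y : p.total) (z w : p'.total) (hz : DualGraph φ y z)
    (hw : DualGraph φ y w) : z = w :=
  eq_of_mem_copenSection_iff fun S hS => (hw S).2 ((hz S).1 hS)

theorem exists_dualGraph {y : p.total} {R : CopenSection p'}
    (hy : y ∈ (φ.toFun R).carrier) : ∃ z, DualGraph φ y z := by
  by_contra! hn
  obtain ⟨T, hRT, -, hT⟩ : ∃ T : CopenSection p', R.carrier ⊆ T.carrier ∧
      T.carrier ⊆ R.carrier ∧ y ∉ (φ.toFun T).carrier := by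
    refine R.isCompact.induction_on (p := fun K => ∃ T : CopenSection p', K ⊆ T.carrier ∧
      T.carrier ⊆ R.carrier ∧ y ∉ (φ.toFun T).carrier) ?_ ?_ ?_ ?_
    · exact ⟨0, Set.empty_subset _, Set.empty_subset _, by rw [φ.map_zero]; exact id⟩
    · rintro K L hKL ⟨T, h, h'⟩
      exact ⟨T, hKL.trans h, h'⟩
    · rintro K L ⟨T, hT, hTR, hyT⟩ ⟨W, hW, hWR, hyW⟩
      refine ⟨T ⊔ W, ?_⟩
      rw [carrier_join_of_injOn R.injOn hTR hWR, φ.map_join]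
      refine ⟨Set.union_subset_union hT hW, Set.union_subset hTR hWR, ?_⟩
      rintro (h | h)
      · exact hyT h
      · exact hyW h.1
    · intro z hz
      suffices ∃ T : CopenSection p', z ∈ T.carrier ∧
          T.carrier ⊆ R.carrier ∧ y ∉ (φ.toFun T).carrier by
        obtain ⟨T, hzT, hT⟩ := this
        exact ⟨_, mem_nhdsWithin_of_mem_nhds (T.isOpen.mem_nhds hzT), T, subset_rfl, hT⟩
      have hzn := hn z
      simp only [DualGraph, not_forall] at hzn
      obtain ⟨T, hT⟩ := hzn
      by_cases hzT : z ∈ T.carrier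
      · refine ⟨R ∩ T, ⟨hz, hzT⟩, Set.inter_subset_left, ?_⟩
        rw [φ.map_inter]
        exact fun h => hT (iff_of_true hzT h.2)
      · have hyT : y ∈ (φ.toFun T).carrier := by
          by_contra hyT
          exact hT (iff_of_false hzT hyT)
        refine ⟨R \ (R ∩ T), ⟨hz, ?_⟩, Set.sdiff_subset, ?_⟩
        · rintro ⟨w, ⟨hwR, hwT⟩, hwz⟩
          exact hzT (R.injOn hwR hz hwz ▸ hwT)
        · rw [φ.map_sdiff, φ.map_inter]
          exact fun h => h.2 (subset_saturation _ ⟨hy, hyT⟩)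
  refine hT ?_
  have h : R ∩ T = R := CopenSection.ext (Set.inter_eq_left.2 hRT)
  rw [← h, φ.map_inter] at hy
  exact hy.2

theorem DualGraph.proj_eq {y y' : p.total} {z z' : p'.total} (h : DualGraph φ y z)
    (h' : DualGraph φ y' z') (hy : p.proj y = p.proj y') : p'.proj z = p'.proj z' := by
  by_contra hz
  obtain ⟨U, V, hU, hV, hzU, hzV, hUV⟩ := t2_separation hz
  obtain ⟨S, hS, hSU⟩ := exists_copenSection_mem (hU.preimage p'.etale.continuous) hzU
  obtain ⟨R, hR, hRV⟩ := exists_copenSection_mem (hV.preimage p'.etale.continuous) hzV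
  have h0 : S ⊓ R = 0 := by
    refine CopenSection.ext (Set.eq_empty_of_forall_notMem ?_)
    rintro w ⟨⟨v, hv, hvw⟩, hw⟩
    exact Set.disjoint_left.1 hUV (hSU hv) (hvw ▸ hRV hw)
  have h1 : y' ∈ (φ.toFun S ⊓ φ.toFun R).carrier := ⟨⟨y, (h S).1 hS, hy⟩, (h' R).1 hR⟩
  rw [← φ.map_meet, h0, φ.map_zero] at h1
  exact h1

theorem DualGraph.exists_lift {y : p.total} {z w : p'.total} (h : DualGraph φ y z)
    (hw : p'.proj w = p'.proj z) : ∃ v, p.proj v = p.proj y ∧ DualGraph φ v w := by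
  obtain ⟨S, hS⟩ := exists_copenSection z
  obtain ⟨R, hR⟩ := exists_copenSection w
  have h1 : y ∈ (φ.toFun (R ⊓ S)).carrier := (h _).1 ⟨⟨w, hR, hw⟩, hS⟩
  rw [φ.map_meet] at h1
  obtain ⟨⟨v, hv, hvy⟩, -⟩ := h1
  obtain ⟨w', hw'⟩ := exists_dualGraph hv
  have : w' = w := R.injOn ((hw' R).2 hv) hR ((hw'.proj_eq h hvy).trans hw.symm)
  exact ⟨v, hvy, this ▸ hw'⟩

/-- The graph of the partial map between the bases dual to a homomorphism. -/
def DualBaseGraph (φ : SkewHom (CopenSection p') (CopenSection p)) (x : p.base) (x' : p'.base) :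
    Prop :=
  ∃ y z, p.proj y = x ∧ DualGraph φ y z ∧ p'.proj z = x'

theorem DualBaseGraph.unique (x : p.base) (x' x'' : p'.base) (h : DualBaseGraph φ x x')
    (h' : DualBaseGraph φ x x'') : x' = x'' := by
  obtain ⟨y, z, hy, hyz, rfl⟩ := h
  obtain ⟨y', z', hy', hyz', rfl⟩ := h'
  exact hyz.proj_eq hyz' (hy.trans hy'.symm)

theorem preimage_dualGraph (R : CopenSection p') :
    (partialMapOfGraph (DualGraph φ)).preimage R.carrier = (φ.toFun R).carrier := by
  ext y
  constructor
  · rintro ⟨z, hz, hyz⟩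
    exact ((mem_partialMapOfGraph DualGraph.unique).1 hyz R).1 hz
  · intro hy
    obtain ⟨z, hz⟩ := exists_dualGraph hy
    exact ⟨z, (hz R).2 hy, (mem_partialMapOfGraph DualGraph.unique).2 hz⟩

theorem preimage_dualBaseGraph (R : CopenSection p') :
    (partialMapOfGraph (DualBaseGraph φ)).preimage (p'.proj '' R.carrier) =
      p.proj '' (φ.toFun R).carrier := by
  ext x
  constructor
  · rintro ⟨_, ⟨w, hw, rfl⟩, hx⟩
    obtain ⟨y, z, rfl, hyz, hz⟩ := (mem_partialMapOfGraph DualBaseGraph.unique).1 hx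
    obtain ⟨v, hv, hvw⟩ := hyz.exists_lift hz.symm
    exact ⟨v, (hvw R).1 hw, hv⟩
  · rintro ⟨y, hy, rfl⟩
    obtain ⟨z, hz⟩ := exists_dualGraph hy
    exact ⟨p'.proj z, ⟨z, (hz R).2 hy, rfl⟩,
      (mem_partialMapOfGraph DualBaseGraph.unique).2 ⟨y, z, rfl, hz, rfl⟩⟩

/-- The morphism of skew Boolean spaces dual to a homomorphism. -/
noncomputable def dualMor (φ : SkewHom (CopenSection p') (CopenSection p)) : p ⟶ p' :=
  SkewBooleanSpace.Mor.mk (p := p) (p' := p')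
    (partialMapOfGraph (DualGraph φ)) (partialMapOfGraph (DualBaseGraph φ))
    (isProperPartial_of_basis (isTopologicalBasis_copenSection p')
      (by
        rintro _ ⟨R, rfl⟩
        rw [preimage_dualGraph]
        exact (φ.toFun R).isOpen)
      (by
        rintro _ ⟨R, rfl⟩
        rw [preimage_dualGraph]
        exact (φ.toFun R).isCompact))
    (isProperPartial_of_basis (isTopologicalBasis_image_copenSection p')
      (by
        rintro _ ⟨R, rfl⟩
        rw [preimage_dualBaseGraph]
        exact isOpen_image _)
      (by
        rintro _ ⟨R, rfl⟩
        rw [preimage_dualBaseGraph]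
        exact isCompact_image _))
    (fun y z h => (mem_partialMapOfGraph DualBaseGraph.unique).2
      ⟨y, z, rfl, (mem_partialMapOfGraph DualGraph.unique).1 h, rfl⟩)
    (by
      intro x x' hx w hw
      obtain ⟨y, z, rfl, hyz, hz⟩ := (mem_partialMapOfGraph DualBaseGraph.unique).1 hx
      obtain ⟨v, hv, hvw⟩ := hyz.exists_lift (hw.trans hz.symm)
      refine ⟨v, ⟨hv, (mem_partialMapOfGraph DualGraph.unique).2 hvw⟩, ?_⟩
      rintro v' ⟨hv', hvw'⟩
      replace hvw' := (mem_partialMapOfGraph DualGraph.unique).1 hvw'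
      obtain ⟨R, hR⟩ := exists_copenSection w
      exact (φ.toFun R).injOn ((hvw' R).1 hR) ((hvw R).1 hR) (hv'.trans hv.symm))

theorem pullbackHom_dualMor (φ : SkewHom (CopenSection p') (CopenSection p)) :
    pullbackHom (dualMor φ) = φ :=
  SkewHom.ext (funext fun R => CopenSection.ext (preimage_dualGraph R))

theorem mem_g_iff (m : p ⟶ p') (y : p.total) (z : p'.total) :
    z ∈ m.g y ↔ DualGraph (pullbackHom m) y z := by
  refine ⟨fun h R => (mem_pullback m R h).symm, fun h => ?_⟩
  obtain ⟨R, hR⟩ := exists_copenSection z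
  obtain ⟨w, -, hw⟩ := (h R).1 hR
  have h' : DualGraph (pullbackHom m) y w := fun R => (mem_pullback m R hw).symm
  rwa [h.unique y z w h']

theorem mem_h_iff (m : p ⟶ p') (x : p.base) (x' : p'.base) :
    x' ∈ m.h x ↔ ∃ y z, p.proj y = x ∧ z ∈ m.g y ∧ p'.proj z = x' := by
  constructor
  · intro hx
    obtain ⟨z, rfl⟩ := p'.surj x'
    obtain ⟨y, ⟨hy, hyz⟩, -⟩ := m.bij_fibres x _ hx z rfl
    exact ⟨y, z, hy, hyz, rfl⟩
  · rintro ⟨y, z, rfl, hyz, rfl⟩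
    exact m.comm y z hyz

theorem pullbackHom_injective : Function.Injective (pullbackHom (p := p) (p' := p')) := by
  intro m n h
  have hg : m.g = n.g := PFun.ext fun y z => by rw [mem_g_iff, mem_g_iff, h]
  refine SkewBooleanSpace.Mor.ext hg (PFun.ext fun x x' => ?_)
  rw [mem_h_iff, mem_h_iff, hg]

end Dual

/-! ## The duality -/

instance full_copenSections : copenSections.{u}.Full where
  map_surjective φ := ⟨(dualMor φ).op, pullbackHom_dualMor φ⟩

instance faithful_copenSections : copenSections.{u}.Faithful where
  map_injective h := Quiver.Hom.unop_inj (pullbackHom_injective h)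

theorem dSaturated_of_isIso {A B : RightHandedSkewAlgebra.{u}} (f : A ⟶ B) [IsIso f] :
    dSaturated f := fun _ _ c _ =>
  ⟨(inv f).toFun c, congrArg (fun g : B ⟶ B => g.toFun c) (IsIso.inv_hom_id f)⟩

/-- The duality functor restricted to morphisms with the lifting property. -/
def liftingCopenSections :
    (WideSubcategory lifting.{u})ᵒᵖ ⥤ WideSubcategory dSaturated.{u} where
  obj p := ⟨copenSections.obj (Opposite.op p.unop.obj)⟩
  map m := ⟨copenSections.map m.unop.hom.op, (dSaturated_iff_lifting _).2 m.unop.property⟩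
  map_id _ := WideSubcategory.hom_ext _ (copenSections.map_id _)
  map_comp m n :=
    WideSubcategory.hom_ext _ (copenSections.map_comp m.unop.hom.op n.unop.hom.op)

instance : liftingCopenSections.{u}.Full where
  map_surjective {p p'} φ := by
    obtain ⟨m, hm⟩ := copenSections.map_surjective φ.hom
    have h : lifting m.unop := (dSaturated_iff_lifting _).1 (by
      rw [Quiver.Hom.op_unop, hm]
      exact φ.property)
    let n : p'.unop ⟶ p.unop := ⟨m.unop, h⟩
    exact ⟨n.op, WideSubcategory.hom_ext _ hm⟩

instance : liftingCopenSections.{u}.Faithful where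
  map_injective {p p' m n} h := by
    apply Quiver.Hom.unop_inj
    apply WideSubcategory.hom_ext
    apply Quiver.Hom.op_inj
    exact copenSections.map_injective (congrArg (fun f => f.hom) h)

instance : liftingCopenSections.{u}.EssSurj where
  mem_essImage A :=
    let e := copenSections.objObjPreimageIso A.obj
    ⟨Opposite.op ⟨(copenSections.objPreimage A.obj).unop⟩,
      ⟨WideSubcategory.isoMk e (dSaturated_of_isIso e.hom) (dSaturated_of_isIso e.inv)⟩⟩

instance : liftingCopenSections.{u}.IsEquivalence where

end SkewDuality

theorem mainTheorem10 :
    (SkewDuality.copenSections.{u}).IsEquivalence ∧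
    (∀ (p p' : SkewDuality.SkewBooleanSpace.{u}) (m : p ⟶ p'),
      SkewDuality.dSaturated (SkewDuality.copenSections.map m.op) ↔ SkewDuality.lifting m) ∧
    ∃ e : (WideSubcategory SkewDuality.lifting.{u})ᵒᵖ ≌ WideSubcategory SkewDuality.dSaturated.{u},
      Nonempty (e.functor ⋙ wideSubcategoryInclusion SkewDuality.dSaturated.{u} ≅
        (wideSubcategoryInclusion SkewDuality.lifting.{u}).op ⋙ SkewDuality.copenSections.{u}) :=
  ⟨{ }, fun _ _ m => SkewDuality.dSaturated_iff_lifting m,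
    SkewDuality.liftingCopenSections.asEquivalence, ⟨NatIso.ofComponents fun _ => Iso.refl _⟩⟩
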